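/- **Theorem 1 (Optimal noise distribution, all-noise limit).** Let $\mu$ be a base measure ("$dx$") and let $p_{\beta}$, $\beta\in\mathbb R^k$ ($k\ge1$), be a well-specified parametric model with data density $p_d=p_{\beta^*}$. Noise-contrastive estimation with noise density $p_n$ and noise-data ratio $\nu>0$ uses the classifier $F(x;\beta)=\log p_\beta(x)-\log(\nu p_n(x))$; its parameter gradient $g(x):=\nabla_\beta F(x;\beta^*)=\nabla_\beta\log p_{\beta}(x)|_{\beta=\beta^*}$ is the (generalized) Fisher score and depends neither on $p_n$ nor on $\nu$. Assume that for $\beta$ near $\beta^*$ the function $p_\beta$ is nonnegative and integrable, that $g$ exists $p_d$-almost everywhere, and that the generalized Fisher information $I:=\mathbb E_{p_d}[gg^\top]$ is finite and invertible. Assume that the model is of one of the following two kinds. * *Normalized:* $\int p_\beta\,d\mu=1$ for $\beta$ near $\beta^*$, where $\beta\mapsto p_\beta(x)$ is differentiable at $\beta^*$ for $\mu$-almost every $x$ and $|p_\beta(x)-p_{\beta^*}(x)|\le B(x)\|\beta-\beta^*\|$ near $\beta^*$ for some integrable $B$ (so that one may differentiate under the integral sign). * *Unnormalized:* $\beta=(\theta,c)$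 and $p_\beta(x)=\tilde p(x;\theta)e^{-c}$ near $\beta^*$, with the log-normalization constant $c$ as a free parameter. For $w(x)=P(Y=0\mid x)=\dfrac{\nu p_n(x)}{p_d(x)+\nu p_n(x)}$ put $m_w=\mathbb E_{p_d}[w g]$ and $I_w=\mathbb E_{p_d}[w gg^\top]$. The asymptotic parametric mean-squared error of logistic NCE with total budget $T>0$ of data and noise points is $$\mathrm{MSE}(T,\nu,p_n)=\frac{\nu+1}{T}\,\mathrm{tr}\Big(I_w^{-1}-\frac{\nu+1}{\nu}\,I_w^{-1}m_wm_w^\top I_w^{-1}\Big).$$ Let $m=\mathbb E_{p_d}[g]$, $M=I^{-1}mm^\top I^{-1}$, $w_1(x)=\|g(x)\|_{I^{-2}}=\sqrt{g(x)^\top I^{-2}g(x)}$, $K=\big(\int p_d w_1\,d\mu\big)^2$, and let $p_d\bullet w_1=p_dw_1/\int p_dw_1\,d\mu$. For densities $p,q$ let $\mathcal D_{\chi^2}(p,q)=\int p^2/q\,d\mu-1\in[0,\infty]$ (with $0/0=0$, and $a/0=\infty$ for $a>0$). Call a noise density $p_n$ *admissible* if $p_n>0$ almost everywhere on $\{p_d>0,\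 g\ne0\}$; this holds in particular if $p_n>0$ wherever $p_d>0$. Set $$p_n^{\mathrm{opt}}:=p_d\bullet w_1 .$$ 1. $K>0$, and $p_n^{\mathrm{opt}}$ is an admissible probability density, equal to $p_d\,\|I^{-1}g\|\big/\int p_d\,\|I^{-1}g\|\,d\mu$. For every admissible $p_n$ and every $\nu>0$, the matrix $I_w$ is invertible. 2. *(All-noise limit.)* For every admissible $p_n$ with $\mathcal D_{\chi^2}(p_d\bullet w_1,p_n)<\infty$, as $\nu\to\infty$, $$\mathrm{MSE}(T,\nu,p_n)=\frac{\nu}{T}\,\mathrm{tr}(I^{-1}-M)+\frac1T\Big(\mathrm{tr}(I^{-1}-2M)+K\big(1+\mathcal D_{\chi^2}(p_d\bullet w_1,p_n)\big)\Big)+o(1).$$ If the divergence is infinite, then $\mathrm{MSE}(T,\nu,p_n)-\frac{\nu}{T}\mathrm{tr}(I^{-1}-M)\to+\infty$. So, at the two leading orders, the error depends on the noise only through $\mathcal D_{\chi^2}(p_d\bullet w_1,p_n)$. 3. *(Optimal noise.)* For every probability density $p_n$, $\mathcal D_{\chi^2}(p_d\bullet w_1,p_n)=0$ if and only if $p_n=p_n^{\mathrm{opt}}$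 almost everywhere. For every admissible $p_n$ that is not almost everywhere equal to $p_n^{\mathrm{opt}}$, $\mathrm{MSE}(T,\nu,p_n^{\mathrm{opt}})<\mathrm{MSE}(T,\nu,p_n)$ for all sufficiently large $\nu$. 4. *(Noise close to the data.)* For every fixed $\nu>0$ there are $C$ and $\delta_0>0$, which do not depend on the noise, such that for every noise density $p_n$ with $p_d/p_n=1+\epsilon$ and $|\epsilon|\le\delta\le\delta_0$ almost everywhere, the divergence $\mathcal D_{\chi^2}(p_d\bullet w_1,p_n)$ is finite and $$\Big|\mathrm{MSE}(T,\nu,p_n)-\frac{(1+\nu)^2}{T\nu}\mathrm{tr}(I^{-1}-M)-\frac{1+\nu}{T\nu}\Big(K\big(1+\mathcal D_{\chi^2}(p_d\bullet w_1,p_n)\big)-\mathrm{tr}(I^{-1})\Big)\Big|\le C\delta^2 .$$ So up to first order in the perturbation the error again depends on the noise only through the same divergence, and by 3 the first-order expression is minimized over all densities exactly by $p_n^{\mathrm{opt}}$. -/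

import Mathlib

open MeasureTheory Filter Topology Matrix

namespace NCE

noncomputable section

/-- A probability density with respect to the base measure `μ`. -/
structure IsDensity {X : Type*} [MeasurableSpace X] (μ : Measure X) (q : X → ℝ) : Prop where
  nonneg : ∀ x, 0 ≤ q x
  integrable : Integrable q μ
  integral_eq_one : ∫ x, q x ∂μ = 1

/-- The model classifier `F(x; β) = log p_β(x) - log (ν p_n(x))`. -/
def classifier {X ι : Type*} (p : EuclideanSpace ℝ ι → X → ℝ) (pn : X → ℝ) (ν : ℝ)
    (β : EuclideanSpace ℝ ι) (x : X) : ℝ :=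
  Real.log (p β x) - Real.log (ν * pn x)

/-- The (generalized) Fisher score at `β₀`, the gradient in `β` of `log p_β(x)`. -/
def score {X ι : Type*} [Fintype ι] (p : EuclideanSpace ℝ ι → X → ℝ)
    (β₀ : EuclideanSpace ℝ ι) (x : X) : EuclideanSpace ℝ ι :=
  gradient (fun β => Real.log (p β x)) β₀

/-- The score is the parameter gradient of the classifier, whatever the noise is. -/
theorem gradient_classifier {X ι : Type*} [Fintype ι] (p : EuclideanSpace ℝ ι → X → ℝ)
    (pn : X → ℝ) (ν : ℝ) (β₀ : EuclideanSpace ℝ ι) (x : X) :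
    gradient (fun β => classifier p pn ν β x) β₀ = score p β₀ x := by
  simp only [score, gradient, classifier, fderiv_sub_const]

/-- The posterior probability `P(Y = 0 | x)` that `x` is a noise point, when noise and data
points come in the ratio `ν`. -/
def noisePosterior {X : Type*} (pd pn : X → ℝ) (ν : ℝ) (x : X) : ℝ :=
  ν * pn x / (pd x + ν * pn x)

/-- The reweighted score mean `m_w = E_{x ∼ pd} [w(x) g(x)]`. -/
def scoreMean {X ι : Type*} [MeasurableSpace X] (μ : Measure X) (pd : X → ℝ)
    (g : X → EuclideanSpace ℝ ι) (w : X → ℝ) : ι → ℝ :=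
  fun i => ∫ x, w x * g x i * pd x ∂μ

/-- The reweighted score second-moment matrix `I_w = E_{x ∼ pd} [w(x) g(x) g(x)ᵀ]`. -/
def scoreCov {X ι : Type*} [MeasurableSpace X] (μ : Measure X) (pd : X → ℝ)
    (g : X → EuclideanSpace ℝ ι) (w : X → ℝ) : Matrix ι ι ℝ :=
  Matrix.of fun i j => ∫ x, w x * (g x i * g x j) * pd x ∂μ

/-- The generalized Fisher information `I = E_{x ∼ pd} [g(x) g(x)ᵀ]`. -/
def fisher {X ι : Type*} [MeasurableSpace X] (μ : Measure X) (pd : X → ℝ)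
    (g : X → EuclideanSpace ℝ ι) : Matrix ι ι ℝ :=
  scoreCov μ pd g (fun _ => 1)

/-- The asymptotic parametric mean-squared error of logistic NCE with total budget `T`,
noise-data ratio `ν` and noise density `pn`:
`(ν + 1) / T * tr (I_w⁻¹ - (ν + 1) / ν * I_w⁻¹ m_w m_wᵀ I_w⁻¹)` with `w(x) = P(Y = 0 | x)`. -/
def mse {X ι : Type*} [MeasurableSpace X] [Fintype ι] [DecidableEq ι] (μ : Measure X)
    (pd : X → ℝ) (g : X → EuclideanSpace ℝ ι) (T ν : ℝ) (pn : X → ℝ) : ℝ :=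
  let Iw := scoreCov μ pd g (noisePosterior pd pn ν)
  let mw := scoreMean μ pd g (noisePosterior pd pn ν)
  (ν + 1) / T *
    Matrix.trace (Iw⁻¹ - ((ν + 1) / ν) • (Iw⁻¹ * Matrix.vecMulVec mw mw * Iw⁻¹))

/-- The norm `‖v‖_A = √⟨v, A v⟩` induced by the metric `A`. -/
def metricNorm {ι : Type*} [Fintype ι] (A : Matrix ι ι ℝ) (v : EuclideanSpace ℝ ι) : ℝ :=
  Real.sqrt (v.ofLp ⬝ᵥ (A *ᵥ v.ofLp))

/-- The normalized product `f g / ∫ f g`. -/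
def normProd {X : Type*} [MeasurableSpace X] (μ : Measure X) (f g : X → ℝ) (x : X) : ℝ :=
  f x * g x / ∫ y, f y * g y ∂μ

/-- The chi-squared divergence `∫ p² / q - 1`, with values in `[0, ∞]`, of two densities.
In `ℝ≥0∞`, `0 / 0 = 0` and `a / 0 = ∞` for `a ≠ 0`, and for densities the integral is at
least `1`. -/
def chiSq {X : Type*} [MeasurableSpace X] (μ : Measure X) (p q : X → ℝ) : ENNReal :=
  (∫⁻ x, ENNReal.ofReal (p x) ^ 2 / ENNReal.ofReal (q x) ∂μ) - 1

/-- Standing assumptions on a well-specified parametric model `p` with true parameter `β₀`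
and data density `p β₀`: near `β₀` the model is nonnegative and integrable, `p β₀` is a
probability density, the score exists on the support of the data, and the Fisher information
is finite and invertible. -/
structure IsRegularModel {X ι : Type*} [MeasurableSpace X] [Fintype ι] [DecidableEq ι]
    (μ : Measure X) (p : EuclideanSpace ℝ ι → X → ℝ) (β₀ : EuclideanSpace ℝ ι) : Prop where
  nonneg : ∀ᶠ β in 𝓝 β₀, ∀ x, 0 ≤ p β x
  integrable : ∀ᶠ β in 𝓝 β₀, Integrable (p β) μ
  isDensity : IsDensity μ (p β₀)
  differentiableAt : ∀ᵐ x ∂μ, 0 < p β₀ x → DifferentiableAt ℝ (fun β => p β x) β₀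
  memLp_score : MemLp (score p β₀) 2 (μ.withDensity fun x => ENNReal.ofReal (p β₀ x))
  isUnit_det_fisher : IsUnit (fisher μ (p β₀) (score p β₀)).det

/-- A normalized model: `∫ p_β = 1` for all `β` near `β₀`, with the usual domination that
allows the differentiation of this identity under the integral sign at `β₀`. -/
structure IsNormalizedModel {X ι : Type*} [MeasurableSpace X] [Fintype ι]
    (μ : Measure X) (p : EuclideanSpace ℝ ι → X → ℝ) (β₀ : EuclideanSpace ℝ ι) : Prop where
  integral_eq_one : ∀ᶠ β in 𝓝 β₀, ∫ x, p β x ∂μ = 1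
  differentiableAt : ∀ᵐ x ∂μ, DifferentiableAt ℝ (fun β => p β x) β₀
  dominated : ∃ r > 0, ∃ B : X → ℝ, Integrable B μ ∧
    ∀ᵐ x ∂μ, ∀ β ∈ Metric.ball β₀ r, |p β x - p β₀ x| ≤ B x * ‖β - β₀‖

/-- An unnormalized model `p(x; (θ, c)) = q(x; θ) / exp c`: one coordinate `j` of
`β = (θ, c)` is the free log-normalization constant `c`, the other ones form `θ`. -/
def IsUnnormalizedModel {X ι : Type*} [Fintype ι]
    (p : EuclideanSpace ℝ ι → X → ℝ) (β₀ : EuclideanSpace ℝ ι) : Prop :=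
  ∃ (j : ι) (q : ({i : ι // i ≠ j} → ℝ) → X → ℝ),
    ∀ᶠ β in 𝓝 β₀, ∀ x, p β x = q (fun i => β i) x / Real.exp (β j)

end

end NCE

/-!
With `u = I⁻¹ g` and `t = p_d / p_n`, the weight is `w = 1 - ρ` for the data posterior
`ρ = t / (t + ν)`, and to second order in `ρ`
`tr I_w⁻¹ = tr I⁻¹ + E[ρ ‖u‖²] + O(E[ρ ‖u‖²]²)`.
The term `‖I_w⁻¹ m_w‖²` does not interfere. An unnormalized model has a direction `v` along which
the score is constantly `1`, so that `I_w v = m_w` and `I_w⁻¹ m_w = v` for every `w`. For a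
normalized model `E[g] = 0`, hence `m_w = -E[ρ g]`, and `‖E[ρ g]‖² ≤ E[ρ] E[ρ ‖g‖²]` by
Cauchy–Schwarz, which is of smaller order than `E[ρ ‖u‖²]`.

As `ν → ∞` the integral `ν E[ρ ‖u‖²]` increases to `E[t ‖u‖²] = ∫ p_d² w₁² / p_n`, finite or not,
and this limit is `K (1 + χ²(p_d • w₁, p_n))`. For noise close to the data,
`w = ν / (1 + ν) * (1 - (t - 1) / (t + ν))`, and the same expansion applies with the small function
`(t - 1) / (t + ν) ≈ (t - 1) / (1 + ν)` in place of `ρ`. Integrating `q² / r + r ≥ 2 q` shows that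
the divergence `χ²(q, r)` vanishes only for `r = q`.
-/

namespace NCE

open scoped Matrix.Norms.L2Operator ENNReal RealInnerProductSpace

section MatrixBounds

variable {ι : Type*} [Fintype ι] [DecidableEq ι]

theorem toEuclideanCLM_vecMulVec_self_apply (v u : EuclideanSpace ℝ ι) :
    toEuclideanCLM (𝕜 := ℝ) (vecMulVec v.ofLp v.ofLp) u = ⟪v, u⟫ • v := by
  ext i
  simp [vecMulVec_apply, mulVec, dotProduct, PiLp.inner_apply, Finset.mul_sum, mul_comm,
    mul_assoc]

theorem norm_vecMulVec_self_le (v : EuclideanSpace ℝ ι) : ‖vecMulVec v.ofLp v.ofLp‖ ≤ ‖v‖ ^ 2 := by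
  refine ContinuousLinearMap.opNorm_le_bound _ (sq_nonneg _) fun u => ?_
  calc ‖toEuclideanCLM (𝕜 := ℝ) (vecMulVec v.ofLp v.ofLp) u‖ = ‖⟪v, u⟫‖ * ‖v‖ := by
        rw [toEuclideanCLM_vecMulVec_self_apply, norm_smul]
    _ ≤ ‖v‖ * ‖u‖ * ‖v‖ := by gcongr; exact norm_inner_le_norm v u
    _ = ‖v‖ ^ 2 * ‖u‖ := by ring

theorem trace_mul_vecMulVec_mul {A : Matrix ι ι ℝ} (hA : A.IsSymm) (v : EuclideanSpace ℝ ι) :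
    (A * vecMulVec v.ofLp v.ofLp * A).trace = ‖toEuclideanCLM (𝕜 := ℝ) A v‖ ^ 2 := by
  rw [mul_vecMulVec, vecMulVec_mul, trace_vecMulVec, ← mulVec_transpose, hA.eq,
    EuclideanSpace.real_norm_sq_eq, dotProduct]
  simp_rw [ofLp_toEuclideanCLM, sq]

theorem isUnit_det_iff_toEuclideanCLM {A : Matrix ι ι ℝ} :
    IsUnit A.det ↔ ∀ v, toEuclideanCLM (𝕜 := ℝ) A v = 0 → v = 0 := by
  rw [← isUnit_iff_isUnit_det, ← isUnit_map_iff (toLpLinAlgEquiv 2),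
    LinearMap.isUnit_iff_ker_eq_bot, LinearMap.ker_eq_bot']
  rfl

theorem exists_trace_inv_sub_le {J : Matrix ι ι ℝ} (hJ : IsUnit J.det) :
    ∃ C, 0 ≤ C ∧ ∃ r > 0, ∀ R : Matrix ι ι ℝ, ‖R‖ ≤ r → IsUnit (J - R).det ∧ ‖(J - R)⁻¹‖ ≤ C ∧
      |(J - R)⁻¹.trace - J⁻¹.trace - (J⁻¹ * R * J⁻¹).trace| ≤ C * ‖R‖ ^ 2 := by
  have : CompleteSpace (Matrix ι ι ℝ) := FiniteDimensional.complete ℝ _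
  lift J to (Matrix ι ι ℝ)ˣ using (isUnit_iff_isUnit_det J).2 hJ
  have hneg : Tendsto (fun R : Matrix ι ι ℝ => -R) (𝓝 0) (𝓝 0) :=
    continuous_neg.tendsto' _ _ neg_zero
  have hunit : ∀ᶠ R : Matrix ι ι ℝ in 𝓝 0, IsUnit (J - R : Matrix ι ι ℝ) :=
    ((continuous_const.sub continuous_id).tendsto' 0 (J : Matrix ι ι ℝ) (sub_zero _)).eventually
      (Units.isOpen.mem_nhds J.isUnit)
  have htrace := ((traceLinearMap ι ℝ ℝ).toContinuousLinearMap.isBigO_comp _ _).trans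
    ((NormedRing.inverse_add_norm_diff_second_order J).comp_tendsto hneg)
  obtain ⟨C₁, hC₁⟩ := ((NormedRing.inverse_add_norm J).comp_tendsto hneg).bound
  obtain ⟨C₂, hC₂⟩ := htrace.bound
  obtain ⟨r, hr, h⟩ := Metric.eventually_nhds_iff_ball.1 (hunit.and (hC₁.and hC₂))
  refine ⟨max (max C₁ C₂) 0, le_max_right _ _, r / 2, half_pos hr, fun R hR => ?_⟩
  obtain ⟨h0, h1, h2⟩ := h R (mem_ball_zero_iff.2 (hR.trans_lt (half_lt_self hr)))
  simp only [Function.comp_apply, ← sub_eq_add_neg, ← nonsing_inv_eq_ringInverse, coe_units_inv,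
    norm_one, mul_one, mul_neg, neg_mul, LinearMap.coe_toContinuousLinearMap', norm_pow, norm_neg,
    traceLinearMap_apply, trace_sub, Real.norm_eq_abs, abs_norm] at h1 h2
  have hC₁C : C₁ ≤ max (max C₁ C₂) 0 := le_max_of_le_left (le_max_left _ _)
  have hC₂C : C₂ ≤ max (max C₁ C₂) 0 := le_max_of_le_left (le_max_right _ _)
  exact ⟨(isUnit_iff_isUnit_det _).1 h0, h1.trans hC₁C, h2.trans (by gcongr)⟩

end MatrixBounds

section Moments

variable {X ι : Type*} [MeasurableSpace X] [Fintype ι]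

/-- The first moment `E[w G]` of a random vector `G` weighted by `w`. -/
noncomputable def firstMoment (P : Measure X) (G : X → EuclideanSpace ℝ ι) (w : X → ℝ) :
    EuclideanSpace ℝ ι :=
  ∫ x, w x • G x ∂P

variable {P : Measure X} {G : X → EuclideanSpace ℝ ι} {w w' : X → ℝ}

theorem integrable_smul [IsFiniteMeasure P] (hG : MemLp G 2 P) (hw : MemLp w ∞ P) :
    Integrable (fun x => w x • G x) P :=
  (hG.integrable one_le_two).smul_of_top_right hw

theorem integrable_mul_norm_sq (hG : MemLp G 2 P) (hw : MemLp w ∞ P) :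
    Integrable (fun x => w x * ‖G x‖ ^ 2) P :=
  (hG.integrable_norm_pow two_ne_zero).smul_of_top_right hw

theorem integrable_smul_inner_smul (hG : MemLp G 2 P) (hw : MemLp w ∞ P)
    (v : EuclideanSpace ℝ ι) : Integrable (fun x => w x • ⟪G x, v⟫ • G x) P := by
  have hinner : MemLp (fun x => ⟪G x, v⟫) 2 P := hG.inner_const v
  have hsmul : MemLp (fun x => ⟪G x, v⟫ • G x) 1 P := hG.smul hinner
  exact (memLp_one_iff_integrable.1 hsmul).smul_of_top_right hw

theorem firstMoment_congr (h : ∀ᵐ x ∂P, G x = 0 ∨ w x = w' x) :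
    firstMoment P G w = firstMoment P G w' :=
  integral_congr_ae (h.mono fun x hx => by rcases hx with hx | hx <;> simp [hx])

theorem firstMoment_const_mul (c : ℝ) :
    firstMoment P G (fun x => c * w x) = c • firstMoment P G w := by
  simp only [firstMoment, mul_smul, integral_smul]

theorem firstMoment_sub [IsFiniteMeasure P] (hG : MemLp G 2 P) (hw : MemLp w ∞ P)
    (hw' : MemLp w' ∞ P) :
    firstMoment P G (fun x => w x - w' x) = firstMoment P G w - firstMoment P G w' := by
  simp only [firstMoment, sub_smul]
  exact integral_sub (integrable_smul hG hw) (integrable_smul hG hw')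

theorem norm_firstMoment_sq_le [IsFiniteMeasure P] (hG : MemLp G 2 P) (hw : MemLp w ∞ P) :
    ‖firstMoment P G w‖ ^ 2 ≤ (∫ x, |w x| ∂P) * ∫ x, |w x| * ‖G x‖ ^ 2 ∂P := by
  have hsqrt : AEStronglyMeasurable (fun x => √|w x|) P :=
    Real.continuous_sqrt.comp_aestronglyMeasurable hw.norm.aestronglyMeasurable
  have hf : MemLp (fun x => √|w x|) 2 P := by
    refine (memLp_two_iff_integrable_sq hsqrt).2 ?_
    simpa only [Real.sq_sqrt (abs_nonneg _)] using (hw.integrable le_top).abs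
  have hg : MemLp (fun x => √|w x| * ‖G x‖) 2 P := by
    refine (memLp_two_iff_integrable_sq (hsqrt.mul hG.aestronglyMeasurable.norm)).2 ?_
    simpa only [Pi.mul_apply, mul_pow, Real.sq_sqrt (abs_nonneg _), Real.norm_eq_abs]
      using integrable_mul_norm_sq hG hw.norm
  have hHolder := integral_mul_le_Lp_mul_Lq_of_nonneg Real.HolderConjugate.two_two
    (.of_forall fun x => Real.sqrt_nonneg |w x|)
    (.of_forall fun x => mul_nonneg (Real.sqrt_nonneg |w x|) (norm_nonneg (G x)))
    (by simpa using hf) (by simpa using hg)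
  simp only [← mul_assoc, Real.mul_self_sqrt (abs_nonneg _), Real.rpow_two, mul_pow,
    Real.sq_sqrt (abs_nonneg _), ← Real.sqrt_eq_rpow] at hHolder
  calc ‖firstMoment P G w‖ ^ 2
      ≤ (√(∫ x, |w x| ∂P) * √(∫ x, |w x| * ‖G x‖ ^ 2 ∂P)) ^ 2 := by
        gcongr
        refine (norm_integral_le_integral_norm _).trans ?_
        simpa only [norm_smul, Real.norm_eq_abs] using hHolder
    _ = _ := by
        rw [mul_pow, Real.sq_sqrt (integral_nonneg fun x => abs_nonneg _),
          Real.sq_sqrt (integral_nonneg fun x => by positivity)]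

variable [DecidableEq ι]

/-- The second-moment matrix `E[w G Gᵀ]` of a random vector `G` weighted by `w`. It is a
Bochner integral for the `L²` operator norm on matrices. -/
noncomputable def secondMoment (P : Measure X) (G : X → EuclideanSpace ℝ ι) (w : X → ℝ) :
    Matrix ι ι ℝ :=
  ∫ x, w x • vecMulVec (G x).ofLp (G x).ofLp ∂P

theorem integrable_smul_vecMulVec (hG : MemLp G 2 P) (hw : MemLp w ∞ P) :
    Integrable (fun x => w x • vecMulVec (G x).ofLp (G x).ofLp) P := by
  have hcont : Continuous fun v : EuclideanSpace ℝ ι => vecMulVec v.ofLp v.ofLp := by fun_prop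
  exact Integrable.smul_of_top_right (.mono' (hG.integrable_norm_pow two_ne_zero)
    (hcont.comp_aestronglyMeasurable hG.aestronglyMeasurable)
    (.of_forall fun x => norm_vecMulVec_self_le (G x))) hw

theorem secondMoment_congr (h : ∀ᵐ x ∂P, G x = 0 ∨ w x = w' x) :
    secondMoment P G w = secondMoment P G w' :=
  integral_congr_ae (h.mono fun x hx => by rcases hx with hx | hx <;> simp [hx])

theorem secondMoment_const_mul (c : ℝ) :
    secondMoment P G (fun x => c * w x) = c • secondMoment P G w := by
  simp only [secondMoment, mul_smul, integral_smul]

theorem secondMoment_sub (hG : MemLp G 2 P) (hw : MemLp w ∞ P) (hw' : MemLp w' ∞ P) :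
    secondMoment P G (fun x => w x - w' x) = secondMoment P G w - secondMoment P G w' := by
  simp only [secondMoment, sub_smul]
  exact integral_sub (integrable_smul_vecMulVec hG hw) (integrable_smul_vecMulVec hG hw')

theorem norm_secondMoment_le (hG : MemLp G 2 P) (hw : MemLp w ∞ P) :
    ‖secondMoment P G w‖ ≤ ∫ x, |w x| * ‖G x‖ ^ 2 ∂P := by
  refine norm_integral_le_of_norm_le (integrable_mul_norm_sq hG hw.norm) (.of_forall fun x => ?_)
  rw [norm_smul]
  exact mul_le_mul_of_nonneg_left (norm_vecMulVec_self_le (G x)) (norm_nonneg _)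

theorem map_secondMoment {E : Type*} [NormedAddCommGroup E] [NormedSpace ℝ E] [CompleteSpace E]
    (hG : MemLp G 2 P) (hw : MemLp w ∞ P) (L : Matrix ι ι ℝ →ₗ[ℝ] E) :
    L (secondMoment P G w) = ∫ x, w x • L (vecMulVec (G x).ofLp (G x).ofLp) ∂P := by
  have : CompleteSpace (Matrix ι ι ℝ) := FiniteDimensional.complete ℝ _
  have h := L.toContinuousLinearMap.integral_comp_comm (integrable_smul_vecMulVec hG hw)
  simpa only [LinearMap.coe_toContinuousLinearMap', map_smul, secondMoment] using h.symm

theorem secondMoment_apply (hG : MemLp G 2 P) (hw : MemLp w ∞ P) (i j : ι) :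
    secondMoment P G w i j = ∫ x, w x * (G x i * G x j) ∂P :=
  map_secondMoment hG hw (entryLinearMap ℝ ℝ i j)

theorem secondMoment_isSymm (hG : MemLp G 2 P) (hw : MemLp w ∞ P) :
    (secondMoment P G w).IsSymm := by
  ext i j
  simp only [transpose_apply, secondMoment_apply hG hw, mul_comm]

theorem trace_mul_secondMoment_mul (hG : MemLp G 2 P) (hw : MemLp w ∞ P) {A : Matrix ι ι ℝ}
    (hA : A.IsSymm) : (A * secondMoment P G w * A).trace =
      ∫ x, w x * ‖toEuclideanCLM (𝕜 := ℝ) A (G x)‖ ^ 2 ∂P := by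
  have h := map_secondMoment hG hw
    (traceLinearMap ι ℝ ℝ ∘ₗ LinearMap.mulRight ℝ A ∘ₗ LinearMap.mulLeft ℝ A)
  simpa [trace_mul_vecMulVec_mul hA] using h

theorem toEuclideanCLM_secondMoment (hG : MemLp G 2 P) (hw : MemLp w ∞ P)
    (v : EuclideanSpace ℝ ι) :
    toEuclideanCLM (𝕜 := ℝ) (secondMoment P G w) v = ∫ x, w x • ⟪G x, v⟫ • G x ∂P := by
  simp only [← toEuclideanCLM_vecMulVec_self_apply]
  exact map_secondMoment hG hw (LinearMap.applyₗ v ∘ₗ (toEuclideanLin (𝕜 := ℝ)).toLinearMap)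

theorem isUnit_det_secondMoment (hG : MemLp G 2 P) (hJ : IsUnit (secondMoment P G 1).det)
    (hw : MemLp w ∞ P) (hpos : ∀ᵐ x ∂P, G x ≠ 0 → 0 < w x) :
    IsUnit (secondMoment P G w).det := by
  rw [isUnit_det_iff_toEuclideanCLM] at hJ ⊢
  refine fun v hv => hJ v ?_
  have hint := integrable_smul_inner_smul hG hw v
  have hquad : ∫ x, ⟪v, w x • ⟪G x, v⟫ • G x⟫ ∂P = 0 := by
    rw [integral_inner hint, ← toEuclideanCLM_secondMoment hG hw, hv, inner_zero_right]
  have hsq (x : X) : ⟪v, w x • ⟪G x, v⟫ • G x⟫ = w x * ⟪G x, v⟫ ^ 2 := by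
    rw [inner_smul_right, inner_smul_right, real_inner_comm, sq]
  simp only [hsq] at hquad
  rw [integral_eq_zero_iff_of_nonneg_ae ?_ ((hint.const_inner v).congr (.of_forall hsq))] at hquad
  · rw [toEuclideanCLM_secondMoment (w := 1) hG (memLp_top_const 1)]
    refine integral_eq_zero_of_ae ?_
    filter_upwards [hquad, hpos] with x hx hwx
    by_cases hGx : G x = 0
    · simp [hGx]
    · have : ⟪G x, v⟫ = 0 := by simpa [(hwx hGx).ne'] using hx
      simp [this]
  · filter_upwards [hpos] with x hwx
    by_cases hGx : G x = 0
    · simp [hGx]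
    · exact mul_nonneg (hwx hGx).le (sq_nonneg _)

/-- The influence function `x ↦ E[G Gᵀ]⁻¹ G(x)`. -/
noncomputable def influence (P : Measure X) (G : X → EuclideanSpace ℝ ι) (x : X) :
    EuclideanSpace ℝ ι :=
  toEuclideanCLM (𝕜 := ℝ) (secondMoment P G 1)⁻¹ (G x)

/-- The first of the two terms of the mean-squared error, `tr E[w G Gᵀ]⁻¹`. -/
noncomputable def varianceTerm (P : Measure X) (G : X → EuclideanSpace ℝ ι) (w : X → ℝ) : ℝ :=
  (secondMoment P G w)⁻¹.trace

/-- The second term of the mean-squared error, `‖E[w G Gᵀ]⁻¹ E[w G]‖²`. -/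
noncomputable def meanTerm (P : Measure X) (G : X → EuclideanSpace ℝ ι) (w : X → ℝ) : ℝ :=
  ‖toEuclideanCLM (𝕜 := ℝ) (secondMoment P G w)⁻¹ (firstMoment P G w)‖ ^ 2

/-- The feature of normalized and of unnormalized models on which the expansions of the error
rest: the score `G` has mean zero, or `⟪G, v⟫ = 1` for some constant vector `v`. -/
def IsCenteredOrCalibrated (P : Measure X) (G : X → EuclideanSpace ℝ ι) : Prop :=
  firstMoment P G 1 = 0 ∨ ∃ v, ∀ᵐ x ∂P, ⟪G x, v⟫ = 1

theorem memLp_influence (hG : MemLp G 2 P) : MemLp (influence P G) 2 P :=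
  (toEuclideanCLM (𝕜 := ℝ) (secondMoment P G 1)⁻¹).comp_memLp' hG

theorem toEuclideanCLM_secondMoment_influence (hJ : IsUnit (secondMoment P G 1).det) (x : X) :
    toEuclideanCLM (𝕜 := ℝ) (secondMoment P G 1) (influence P G x) = G x := by
  rw [influence, ← mul_apply_eq_comp, ← map_mul, mul_nonsing_inv _ hJ, map_one,
    one_apply_eq_self]

theorem isSymm_inv_secondMoment_one (hG : MemLp G 2 P) : (secondMoment P G 1)⁻¹.IsSymm :=
  (secondMoment_isSymm hG (w := 1) (memLp_top_const 1)).inv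

theorem integral_mul_norm_sq_le_influence (hG : MemLp G 2 P)
    (hJ : IsUnit (secondMoment P G 1).det) (hw : MemLp w ∞ P) :
    ∫ x, |w x| * ‖G x‖ ^ 2 ∂P ≤
      ‖secondMoment P G 1‖ ^ 2 * ∫ x, |w x| * ‖influence P G x‖ ^ 2 ∂P := by
  rw [← integral_const_mul]
  refine integral_mono (integrable_mul_norm_sq hG hw.norm)
    ((integrable_mul_norm_sq (memLp_influence hG) hw.norm).const_mul _) fun x => ?_
  have hle : ‖G x‖ ≤ ‖secondMoment P G 1‖ * ‖influence P G x‖ := by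
    conv_lhs => rw [← toEuclideanCLM_secondMoment_influence hJ x]
    exact ContinuousLinearMap.le_opNorm _ _
  calc |w x| * ‖G x‖ ^ 2 ≤ |w x| * (‖secondMoment P G 1‖ * ‖influence P G x‖) ^ 2 := by gcongr
    _ = _ := by ring

theorem varianceTerm_one (hG : MemLp G 2 P) (hJ : IsUnit (secondMoment P G 1).det) :
    varianceTerm P G 1 = ∫ x, ‖influence P G x‖ ^ 2 ∂P := by
  have h := trace_mul_secondMoment_mul (w := 1) hG (memLp_top_const 1)
    (isSymm_inv_secondMoment_one hG)
  rw [nonsing_inv_mul _ hJ, one_mul] at h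
  simpa only [varianceTerm, influence, Pi.one_apply, one_mul] using h

theorem meanTerm_of_calibrated (hG : MemLp G 2 P) (hw : MemLp w ∞ P)
    (hS : IsUnit (secondMoment P G w).det) {v : EuclideanSpace ℝ ι}
    (hv : ∀ᵐ x ∂P, ⟪G x, v⟫ = 1) : meanTerm P G w = ‖v‖ ^ 2 := by
  have h : toEuclideanCLM (𝕜 := ℝ) (secondMoment P G w) v = firstMoment P G w := by
    rw [toEuclideanCLM_secondMoment hG hw]
    exact integral_congr_ae (hv.mono fun x hx => by simp only [hx, one_smul])
  rw [meanTerm, ← h, ← mul_apply_eq_comp, ← map_mul, nonsing_inv_mul _ hS, map_one,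
    one_apply_eq_self]

theorem inv_secondMoment_const_mul {c : ℝ} (hc : c ≠ 0) (hS : IsUnit (secondMoment P G w).det) :
    (secondMoment P G fun x => c * w x)⁻¹ = c⁻¹ • (secondMoment P G w)⁻¹ := by
  rw [secondMoment_const_mul]
  exact inv_smul' _ (Units.mk0 c hc) hS

theorem varianceTerm_const_mul {c : ℝ} (hc : c ≠ 0) (hS : IsUnit (secondMoment P G w).det) :
    varianceTerm P G (fun x => c * w x) = c⁻¹ * varianceTerm P G w := by
  rw [varianceTerm, inv_secondMoment_const_mul hc hS, trace_smul, smul_eq_mul, varianceTerm]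

theorem meanTerm_const_mul {c : ℝ} (hc : c ≠ 0) (hS : IsUnit (secondMoment P G w).det) :
    meanTerm P G (fun x => c * w x) = meanTerm P G w := by
  rw [meanTerm, inv_secondMoment_const_mul hc hS, firstMoment_const_mul, map_smul, map_smul,
    _root_.smul_apply, smul_inv_smul₀ hc, meanTerm]

theorem memLp_top_one_sub {ρ : X → ℝ} (hρ : MemLp ρ ∞ P) : MemLp (fun x => 1 - ρ x) ∞ P :=
  (memLp_top_const 1).sub hρ

theorem exists_varianceTerm_one_sub_le (hG : MemLp G 2 P)
    (hJ : IsUnit (secondMoment P G 1).det) :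
    ∃ C, 0 ≤ C ∧ ∃ r > 0, ∀ ρ : X → ℝ, MemLp ρ ∞ P → ∫ x, |ρ x| * ‖influence P G x‖ ^ 2 ∂P ≤ r →
      IsUnit (secondMoment P G fun x => 1 - ρ x).det ∧
      ‖(secondMoment P G fun x => 1 - ρ x)⁻¹‖ ≤ C ∧
      |varianceTerm P G (fun x => 1 - ρ x) - varianceTerm P G 1
        - ∫ x, ρ x * ‖influence P G x‖ ^ 2 ∂P| ≤
        C * (∫ x, |ρ x| * ‖influence P G x‖ ^ 2 ∂P) ^ 2 := by
  obtain ⟨C, hC, r, hr, h⟩ := exists_trace_inv_sub_le hJ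
  set a := ‖secondMoment P G 1‖ ^ 2
  have : 0 ≤ a := sq_nonneg _
  refine ⟨max C (C * a ^ 2), le_max_of_le_left hC, r / (a + 1), by positivity, fun ρ hρ hτ => ?_⟩
  set τ := ∫ x, |ρ x| * ‖influence P G x‖ ^ 2 ∂P with hτ_def
  have hR : ‖secondMoment P G ρ‖ ≤ a * τ :=
    (norm_secondMoment_le hG hρ).trans (integral_mul_norm_sq_le_influence hG hJ hρ)
  have hτ0 : 0 ≤ τ := integral_nonneg fun x => by positivity
  have hRr : ‖secondMoment P G ρ‖ ≤ r := by
    rw [le_div_iff₀ (by positivity)] at hτ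
    linarith
  obtain ⟨hdet, hnorm, htr⟩ := h _ hRr
  have hsub : secondMoment P G (fun x => 1 - ρ x) = secondMoment P G 1 - secondMoment P G ρ :=
    secondMoment_sub (w := 1) hG (memLp_top_const 1) hρ
  rw [trace_mul_secondMoment_mul hG hρ (isSymm_inv_secondMoment_one hG)] at htr
  rw [varianceTerm, varianceTerm, hsub]
  refine ⟨hdet, hnorm.trans (le_max_left _ _), htr.trans ?_⟩
  calc C * ‖secondMoment P G ρ‖ ^ 2 ≤ C * (a * τ) ^ 2 := by gcongr
    _ = C * a ^ 2 * τ ^ 2 := by ring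
    _ ≤ _ := by gcongr; exact le_max_right _ _

theorem exists_meanTerm_one_sub_le [IsFiniteMeasure P] (hG : MemLp G 2 P)
    (hJ : IsUnit (secondMoment P G 1).det) (hcal : IsCenteredOrCalibrated P G) :
    ∃ C, 0 ≤ C ∧ ∃ r > 0, ∀ ρ : X → ℝ, MemLp ρ ∞ P → ∫ x, |ρ x| * ‖influence P G x‖ ^ 2 ∂P ≤ r →
      |meanTerm P G (fun x => 1 - ρ x) - meanTerm P G 1| ≤
        C * ((∫ x, |ρ x| ∂P) * ∫ x, |ρ x| * ‖influence P G x‖ ^ 2 ∂P) := by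
  obtain ⟨C, -, r, hr, h⟩ := exists_varianceTerm_one_sub_le hG hJ
  refine ⟨C ^ 2 * ‖secondMoment P G 1‖ ^ 2, by positivity, r, hr, fun ρ hρ hτ => ?_⟩
  obtain ⟨hdet, hnorm, -⟩ := h ρ hρ hτ
  rcases hcal with hcen | ⟨v, hv⟩
  · have hmean : firstMoment P G (fun x => 1 - ρ x) = -firstMoment P G ρ := by
      rw [← zero_sub, ← hcen]
      exact firstMoment_sub (w := 1) hG (memLp_top_const 1) hρ
    calc |meanTerm P G (fun x => 1 - ρ x) - meanTerm P G 1|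
        = ‖toEuclideanCLM (𝕜 := ℝ) (secondMoment P G fun x => 1 - ρ x)⁻¹
            (firstMoment P G ρ)‖ ^ 2 := by
          simp [meanTerm, hcen, hmean]
      _ ≤ (C * ‖firstMoment P G ρ‖) ^ 2 := by
          gcongr
          exact ContinuousLinearMap.le_of_opNorm_le _ hnorm _
      _ ≤ C ^ 2 * ((∫ x, |ρ x| ∂P) *
            (‖secondMoment P G 1‖ ^ 2 * ∫ x, |ρ x| * ‖influence P G x‖ ^ 2 ∂P)) := by
          rw [mul_pow]
          gcongr
          refine (norm_firstMoment_sq_le hG hρ).trans ?_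
          exact mul_le_mul_of_nonneg_left (integral_mul_norm_sq_le_influence hG hJ hρ)
            (integral_nonneg fun x => abs_nonneg (ρ x))
      _ = _ := by ring
  · rw [meanTerm_of_calibrated hG (memLp_top_one_sub hρ) hdet hv,
      meanTerm_of_calibrated hG (w := 1) (memLp_top_const 1) hJ hv, sub_self, abs_zero]
    positivity

end Moments

section AllNoise

variable {X : Type*}

/-- The posterior probability `P(Y = 1 | x)` that `x` is a data point, where `t` is the density
ratio of the data to the noise and `ν` is the noise-data ratio. -/
noncomputable def dataPosterior (t : X → ℝ) (ν : ℝ) (x : X) : ℝ :=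
  t x / (t x + ν)

variable {t : X → ℝ} {ν : ℝ}

theorem dataPosterior_nonneg (ht : ∀ x, 0 ≤ t x) (hν : 0 < ν) (x : X) :
    0 ≤ dataPosterior t ν x :=
  div_nonneg (ht x) (add_nonneg (ht x) hν.le)

theorem norm_dataPosterior_le_one (ht : ∀ x, 0 ≤ t x) (hν : 0 < ν) (x : X) :
    ‖dataPosterior t ν x‖ ≤ 1 := by
  rw [Real.norm_of_nonneg (dataPosterior_nonneg ht hν x)]
  exact div_le_one_of_le₀ (le_add_of_nonneg_right hν.le) (add_nonneg (ht x) hν.le)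

theorem tendsto_dataPosterior_atTop (x : X) :
    Tendsto (fun ν => dataPosterior t ν x) atTop (𝓝 0) :=
  (tendsto_atTop_add_const_left _ _ tendsto_id).const_div_atTop _

theorem mul_dataPosterior_le (ht : ∀ x, 0 ≤ t x) (hν : 0 < ν) (x : X) :
    ν * dataPosterior t ν x ≤ t x := by
  have := ht x
  rw [dataPosterior, mul_div_assoc', div_le_iff₀ (by positivity)]
  nlinarith

theorem tendsto_mul_dataPosterior_atTop (x : X) :
    Tendsto (fun ν => ν * dataPosterior t ν x) atTop (𝓝 (t x)) := by
  have h : Tendsto (fun ν => t x - t x * dataPosterior t ν x) atTop (𝓝 (t x)) := by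
    simpa using ((tendsto_dataPosterior_atTop x).const_mul (t x)).const_sub (t x)
  refine h.congr' ?_
  filter_upwards [eventually_gt_atTop (-t x)] with ν hν
  have : t x + ν ≠ 0 := by linarith
  rw [dataPosterior]
  field_simp
  ring

variable [MeasurableSpace X] {P : Measure X}

theorem aestronglyMeasurable_dataPosterior (htm : AEMeasurable t P) (ν : ℝ) :
    AEStronglyMeasurable (dataPosterior t ν) P :=
  (htm.div (htm.add_const ν)).aestronglyMeasurable

theorem memLp_dataPosterior (ht : ∀ x, 0 ≤ t x) (htm : AEMeasurable t P) (hν : 0 < ν) :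
    MemLp (dataPosterior t ν) ∞ P :=
  memLp_top_of_bound (aestronglyMeasurable_dataPosterior htm ν) 1
    (.of_forall (norm_dataPosterior_le_one ht hν))

theorem integral_dataPosterior_mul_nonneg (ht : ∀ x, 0 ≤ t x) (hν : 0 < ν) {f : X → ℝ}
    (hf : ∀ x, 0 ≤ f x) : 0 ≤ ∫ x, dataPosterior t ν x * f x ∂P :=
  integral_nonneg fun x => mul_nonneg (dataPosterior_nonneg ht hν x) (hf x)

theorem tendsto_integral_dataPosterior_mul (ht : ∀ x, 0 ≤ t x) (htm : AEMeasurable t P)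
    {f : X → ℝ} (hf : Integrable f P) :
    Tendsto (fun ν => ∫ x, dataPosterior t ν x * f x ∂P) atTop (𝓝 0) := by
  rw [← integral_zero X ℝ (μ := P)]
  refine tendsto_integral_filter_of_dominated_convergence (fun x => ‖f x‖)
    (.of_forall fun ν => (aestronglyMeasurable_dataPosterior htm ν).mul hf.1) ?_ hf.norm
    (.of_forall fun x => ?_)
  · filter_upwards [eventually_gt_atTop 0] with ν hν
    refine .of_forall fun x => ?_
    rw [norm_mul]
    exact mul_le_of_le_one_left (norm_nonneg _) (norm_dataPosterior_le_one ht hν x)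
  · simpa using (tendsto_dataPosterior_atTop x).mul_const (f x)

theorem tendsto_lintegral_of_le {α : Type*} {l : Filter α} [l.IsCountablyGenerated]
    {F : α → X → ENNReal} {f : X → ENNReal} (hF : ∀ a, AEMeasurable (F a) P)
    (hle : ∀ᶠ a in l, ∀ x, F a x ≤ f x) (hlim : ∀ x, Tendsto (fun a => F a x) l (𝓝 (f x))) :
    Tendsto (fun a => ∫⁻ x, F a x ∂P) l (𝓝 (∫⁻ x, f x ∂P)) := by
  rcases l.eq_or_neBot with rfl | _
  · exact tendsto_bot
  refine tendsto_of_le_liminf_of_limsup_le ?_ (limsup_le_of_le (h := hle.mono fun a ha => ?_))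
  · calc ∫⁻ x, f x ∂P = ∫⁻ x, liminf (fun a => F a x) l ∂P := by
          simp only [fun x => (hlim x).liminf_eq]
      _ ≤ _ := lintegral_liminf_le' hF
  · exact lintegral_mono ha

theorem tendsto_ofReal_mul_integral_dataPosterior (ht : ∀ x, 0 ≤ t x) (htm : AEMeasurable t P)
    {f : X → ℝ} (hf : Integrable f P) (hf0 : ∀ x, 0 ≤ f x) :
    Tendsto (fun ν => ENNReal.ofReal (ν * ∫ x, dataPosterior t ν x * f x ∂P)) atTop
      (𝓝 (∫⁻ x, ENNReal.ofReal (t x * f x) ∂P)) := by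
  have hmeas (ν : ℝ) :
      AEMeasurable (fun x => ENNReal.ofReal (ν * dataPosterior t ν x * f x)) P :=
    (((aestronglyMeasurable_dataPosterior htm ν).aemeasurable.const_mul ν).mul
      hf.aemeasurable).ennreal_ofReal
  have hle : ∀ᶠ ν in atTop, ∀ x,
      ENNReal.ofReal (ν * dataPosterior t ν x * f x) ≤ ENNReal.ofReal (t x * f x) := by
    filter_upwards [eventually_gt_atTop 0] with ν hν x
    exact ENNReal.ofReal_le_ofReal
      (mul_le_mul_of_nonneg_right (mul_dataPosterior_le ht hν x) (hf0 x))
  refine (tendsto_lintegral_of_le hmeas hle fun x => ENNReal.tendsto_ofReal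
    ((tendsto_mul_dataPosterior_atTop x).mul_const (f x))).congr' ?_
  filter_upwards [eventually_gt_atTop 0] with ν hν
  have hint : Integrable (fun x => ν * dataPosterior t ν x * f x) P :=
    hf.smul_of_top_right ((memLp_dataPosterior ht htm hν).const_mul ν)
  rw [← integral_const_mul, ← ofReal_integral_eq_lintegral_ofReal hint (.of_forall fun x =>
    mul_nonneg (mul_nonneg hν.le (dataPosterior_nonneg ht hν x)) (hf0 x))]
  simp only [mul_assoc]

variable {ι : Type*} [Fintype ι] [DecidableEq ι] {G : X → EuclideanSpace ℝ ι}

/-- The expression `mse` with an arbitrary measure `P` and an arbitrary weight `w` in place of the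
law of the data and of the posterior probability of the noise. -/
noncomputable def asymptoticMSE (P : Measure X) (G : X → EuclideanSpace ℝ ι) (T ν : ℝ)
    (w : X → ℝ) : ℝ :=
  (ν + 1) / T * (varianceTerm P G w - (ν + 1) / ν * meanTerm P G w)

open Asymptotics

theorem isEquivalent_sub_of_isBigO {V Q a b : ℝ → ℝ} (ha : Tendsto a atTop (𝓝 0))
    (hb : Tendsto b atTop (𝓝 0)) (hV : (fun ν => V ν - a ν) =O[atTop] fun ν => a ν * a ν)
    (hQ : Q =O[atTop] fun ν => b ν * a ν) :
    (fun ν => (ν + 1) * V ν - (ν + 1) ^ 2 / ν * Q ν) ~[atTop] fun ν => ν * a ν := by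
  have hratio : Tendsto (fun ν : ℝ => (ν + 1) / ν) atTop (𝓝 1) := by
    refine (by simpa using tendsto_inv_atTop_zero.const_add (1 : ℝ) :
      Tendsto (fun ν : ℝ => 1 + ν⁻¹) atTop (𝓝 1)).congr' ?_
    filter_upwards [eventually_ne_atTop 0] with ν hν
    field_simp
  have hmul {c : ℝ → ℝ} (hc : Tendsto c atTop (𝓝 0)) : (fun ν => c ν * a ν) =o[atTop] a := by
    simpa using ((isLittleO_one_iff ℝ).2 hc).mul_isBigO (isBigO_refl a atTop)
  have hVa : (fun ν => (ν + 1) / ν * V ν) ~[atTop] a := by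
    simpa [Pi.mul_def] using ((isEquivalent_const_iff_tendsto one_ne_zero).2 hratio).mul
      (hV.trans_isLittleO (hmul ha))
  have hQa : (fun ν => ((ν + 1) / ν) ^ 2 * Q ν) =o[atTop] a := by
    simpa using ((hratio.pow 2).isBigO_one ℝ).mul_isLittleO (hQ.trans_isLittleO (hmul hb))
  refine (IsEquivalent.refl.mul (hVa.sub_isLittleO hQa)).congr_left ?_
  filter_upwards [eventually_ne_atTop 0] with ν hν
  simp only [Pi.mul_apply, Pi.sub_apply]
  field_simp

theorem asymptoticMSE_sub_eq (w : X → ℝ) (T : ℝ) {ν : ℝ} (hν : ν ≠ 0) :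
    asymptoticMSE P G T ν w - ν / T * (varianceTerm P G 1 - meanTerm P G 1) =
      1 / T * (varianceTerm P G 1 - (2 + ν⁻¹) * meanTerm P G 1 +
        ((ν + 1) * (varianceTerm P G w - varianceTerm P G 1) -
          (ν + 1) ^ 2 / ν * (meanTerm P G w - meanTerm P G 1))) := by
  rw [asymptoticMSE]
  field_simp
  ring

theorem tendsto_const_sub_two_add_inv_mul (V Q : ℝ) :
    Tendsto (fun ν : ℝ => V - (2 + ν⁻¹) * Q) atTop (𝓝 (V - 2 * Q)) := by
  simpa using ((tendsto_inv_atTop_zero.const_add 2).mul_const Q).const_sub V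

theorem isEquivalent_excess [IsFiniteMeasure P] (hG : MemLp G 2 P)
    (hJ : IsUnit (secondMoment P G 1).det) (hcal : IsCenteredOrCalibrated P G)
    (ht : ∀ x, 0 ≤ t x) (htm : AEMeasurable t P) :
    (fun ν =>
        (ν + 1) * (varianceTerm P G (fun x => 1 - dataPosterior t ν x) - varianceTerm P G 1) -
          (ν + 1) ^ 2 / ν * (meanTerm P G (fun x => 1 - dataPosterior t ν x) - meanTerm P G 1))
      ~[atTop] fun ν => ν * ∫ x, dataPosterior t ν x * ‖influence P G x‖ ^ 2 ∂P := by
  have ha := tendsto_integral_dataPosterior_mul ht htm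
    ((memLp_influence hG).integrable_norm_pow two_ne_zero)
  have hb : Tendsto (fun ν => ∫ x, dataPosterior t ν x ∂P) atTop (𝓝 0) := by
    simpa using tendsto_integral_dataPosterior_mul ht htm (integrable_const (1 : ℝ))
  have habs {ν : ℝ} (hν : 0 < ν) (x : X) : |dataPosterior t ν x| = dataPosterior t ν x :=
    abs_of_nonneg (dataPosterior_nonneg ht hν x)
  refine isEquivalent_sub_of_isBigO ha hb ?_ ?_
  · obtain ⟨C, -, r, hr, h⟩ := exists_varianceTerm_one_sub_le hG hJ
    refine .of_bound C ?_
    filter_upwards [eventually_gt_atTop 0, ha.eventually_le_const hr] with ν hν hνr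
    have := (h _ (memLp_dataPosterior ht htm hν) (by simpa only [habs hν] using hνr)).2.2
    simpa only [habs hν, ← sq, norm_pow, Real.norm_eq_abs, sq_abs] using this
  · obtain ⟨C, -, r, hr, h⟩ := exists_meanTerm_one_sub_le hG hJ hcal
    refine .of_bound C ?_
    filter_upwards [eventually_gt_atTop 0, ha.eventually_le_const hr] with ν hν hνr
    have hba := mul_nonneg (integral_nonneg (μ := P) fun x => dataPosterior_nonneg ht hν x)
      (integral_dataPosterior_mul_nonneg (P := P) ht hν fun x => sq_nonneg ‖influence P G x‖)
    have := h _ (memLp_dataPosterior ht htm hν) (by simpa only [habs hν] using hνr)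
    simpa only [habs hν, Real.norm_eq_abs, abs_of_nonneg hba] using this

theorem tendsto_asymptoticMSE_sub [IsFiniteMeasure P] (hG : MemLp G 2 P)
    (hJ : IsUnit (secondMoment P G 1).det) (hcal : IsCenteredOrCalibrated P G)
    (ht : ∀ x, 0 ≤ t x) (htm : AEMeasurable t P) (T : ℝ)
    (hfin : ∫⁻ x, ENNReal.ofReal (t x * ‖influence P G x‖ ^ 2) ∂P ≠ ⊤) :
    Tendsto (fun ν => asymptoticMSE P G T ν (fun x => 1 - dataPosterior t ν x) -
        ν / T * (varianceTerm P G 1 - meanTerm P G 1)) atTop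
      (𝓝 (1 / T * (varianceTerm P G 1 - 2 * meanTerm P G 1 +
        (∫⁻ x, ENNReal.ofReal (t x * ‖influence P G x‖ ^ 2) ∂P).toReal))) := by
  have hlim := (ENNReal.tendsto_toReal hfin).comp (tendsto_ofReal_mul_integral_dataPosterior ht htm
    ((memLp_influence hG).integrable_norm_pow two_ne_zero) fun x => sq_nonneg _)
  have hlim' := hlim.congr' (f₂ := fun ν =>
      ν * ∫ x, dataPosterior t ν x * ‖influence P G x‖ ^ 2 ∂P) <| by
    filter_upwards [eventually_gt_atTop 0] with ν hν
    exact ENNReal.toReal_ofReal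
      (mul_nonneg hν.le (integral_dataPosterior_mul_nonneg ht hν fun x => sq_nonneg _))
  have hexcess := (isEquivalent_excess hG hJ hcal ht htm).symm.tendsto_nhds hlim'
  refine (((tendsto_const_sub_two_add_inv_mul _ _).add hexcess).const_mul (1 / T)).congr' ?_
  filter_upwards [eventually_ne_atTop 0] with ν hν
  exact (asymptoticMSE_sub_eq _ _ hν).symm

theorem tendsto_asymptoticMSE_sub_atTop [IsFiniteMeasure P] (hG : MemLp G 2 P)
    (hJ : IsUnit (secondMoment P G 1).det) (hcal : IsCenteredOrCalibrated P G)
    (ht : ∀ x, 0 ≤ t x) (htm : AEMeasurable t P)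
    {T : ℝ} (hT : 0 < T) (hinf : ∫⁻ x, ENNReal.ofReal (t x * ‖influence P G x‖ ^ 2) ∂P = ⊤) :
    Tendsto (fun ν => asymptoticMSE P G T ν (fun x => 1 - dataPosterior t ν x) -
        ν / T * (varianceTerm P G 1 - meanTerm P G 1)) atTop atTop := by
  have hlim := tendsto_ofReal_mul_integral_dataPosterior ht htm
    ((memLp_influence hG).integrable_norm_pow two_ne_zero) fun x => sq_nonneg _
  rw [hinf, ENNReal.tendsto_ofReal_nhds_top] at hlim
  have hexcess := (isEquivalent_excess hG hJ hcal ht htm).symm.tendsto_atTop hlim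
  refine (((tendsto_const_sub_two_add_inv_mul (varianceTerm P G 1) (meanTerm P G 1)).add_atTop
    hexcess).const_mul_atTop (one_div_pos.2 hT)).congr' ?_
  filter_upwards [eventually_ne_atTop 0] with ν hν
  exact (asymptoticMSE_sub_eq _ _ hν).symm

end AllNoise

section NearData

theorem abs_sub_one_div_add_le {t ν δ : ℝ} (hν : 0 < ν) (hδ : δ ≤ 1 / 2) (ht : |t - 1| ≤ δ) :
    |(t - 1) / (t + ν)| ≤ 2 * δ := by
  have htν : 1 / 2 ≤ t + ν := by linarith [(abs_le.1 ht).1]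
  rw [abs_div, abs_of_pos (by linarith : 0 < t + ν), div_le_iff₀ (by linarith)]
  nlinarith [abs_nonneg (t - 1)]

theorem abs_sub_one_div_add_sub_le {t ν δ : ℝ} (hν : 0 < ν) (hδ : δ ≤ 1 / 2)
    (ht : |t - 1| ≤ δ) : |(t - 1) / (t + ν) - (t - 1) / (1 + ν)| ≤ 2 * δ ^ 2 := by
  have htν : t + ν ≠ 0 := by linarith [(abs_le.1 ht).1]
  have h : (t - 1) / (t + ν) - (t - 1) / (1 + ν) =
      -((t - 1) / (t + ν) * (t - 1) / (1 + ν)) := by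
    field_simp
    ring
  have hδ0 : 0 ≤ δ := (abs_nonneg _).trans ht
  calc |(t - 1) / (t + ν) - (t - 1) / (1 + ν)|
      = |(t - 1) / (t + ν)| * |t - 1| / (1 + ν) := by
        rw [h, abs_neg, abs_div, abs_mul, abs_of_pos (by linarith : 0 < 1 + ν)]
    _ ≤ 2 * δ * δ / 1 := by
        gcongr
        · exact abs_sub_one_div_add_le hν hδ ht
        · linarith
    _ = 2 * δ ^ 2 := by ring

theorem one_sub_dataPosterior_eq {X : Type*} {t : X → ℝ} {ν : ℝ} {x : X} (hν : 0 < ν)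
    (h : t x + ν ≠ 0) :
    1 - dataPosterior t ν x = ν / (1 + ν) * (1 - (t x - 1) / (t x + ν)) := by
  rw [dataPosterior]
  field_simp
  ring

variable {X ι : Type*} [MeasurableSpace X] [Fintype ι] [DecidableEq ι] {P : Measure X}
  {G : X → EuclideanSpace ℝ ι}

theorem asymptoticMSE_congr {w w' : X → ℝ} (h : ∀ᵐ x ∂P, G x = 0 ∨ w x = w' x) (T ν : ℝ) :
    asymptoticMSE P G T ν w = asymptoticMSE P G T ν w' := by
  simp only [asymptoticMSE, varianceTerm, meanTerm, secondMoment_congr h, firstMoment_congr h]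

theorem asymptoticMSE_const_mul {w : X → ℝ} (hS : IsUnit (secondMoment P G w).det) (T : ℝ) {ν : ℝ}
    (hν : 0 < ν) : asymptoticMSE P G T ν (fun x => ν / (1 + ν) * w x) =
      (1 + ν) ^ 2 / (T * ν) * (varianceTerm P G w - meanTerm P G w) := by
  have hc : ν / (1 + ν) ≠ 0 := by positivity
  rw [asymptoticMSE, varianceTerm_const_mul hc hS, meanTerm_const_mul hc hS]
  field_simp
  ring

theorem integral_abs_mul_le {ρ f : X → ℝ} (hρ : MemLp ρ ∞ P) {δ : ℝ} (hρδ : ∀ᵐ x ∂P, |ρ x| ≤ δ)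
    (hf : Integrable f P) (hf0 : ∀ x, 0 ≤ f x) :
    ∫ x, |ρ x| * f x ∂P ≤ δ * ∫ x, f x ∂P := by
  rw [← integral_const_mul]
  exact integral_mono_ae (hf.smul_of_top_right hρ.norm) (hf.const_mul δ)
    (hρδ.mono fun x hx => mul_le_mul_of_nonneg_right hx (hf0 x))

theorem memLp_top_of_abs_sub_one_le {t : X → ℝ} (htm : AEMeasurable t P) {δ : ℝ}
    (ht : ∀ᵐ x ∂P, |t x - 1| ≤ δ) : MemLp t ∞ P :=
  memLp_top_of_bound htm.aestronglyMeasurable (1 + δ) (ht.mono fun x hx => by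
    rw [Real.norm_eq_abs, abs_le]
    constructor <;> linarith [abs_le.1 hx])

theorem memLp_top_sub_one_div_add {t : X → ℝ} (htm : AEMeasurable t P) {ν δ : ℝ} (hν : 0 < ν)
    (hδ : δ ≤ 1 / 2) (ht : ∀ᵐ x ∂P, |t x - 1| ≤ δ) :
    MemLp (fun x => (t x - 1) / (t x + ν)) ∞ P :=
  memLp_top_of_bound ((htm.sub_const 1).div (htm.add_const ν)).aestronglyMeasurable (2 * δ)
    (ht.mono fun _ hx => abs_sub_one_div_add_le hν hδ hx)

theorem abs_integral_sub_one_div_add_le {t : X → ℝ} (htm : AEMeasurable t P) {ν δ : ℝ}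
    (hν : 0 < ν) (hδ : δ ≤ 1 / 2) (ht : ∀ᵐ x ∂P, |t x - 1| ≤ δ) {f : X → ℝ} (hf : Integrable f P)
    (hf0 : ∀ x, 0 ≤ f x) :
    |∫ x, (t x - 1) / (t x + ν) * f x ∂P - (∫ x, t x * f x ∂P - ∫ x, f x ∂P) / (1 + ν)| ≤
      2 * δ ^ 2 * ∫ x, f x ∂P := by
  have ht_top := memLp_top_of_abs_sub_one_le htm ht
  have hρ := memLp_top_sub_one_div_add htm hν hδ ht
  have htf : Integrable (fun x => t x * f x) P := hf.smul_of_top_right ht_top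
  have hρf : Integrable (fun x => (t x - 1) / (t x + ν) * f x) P := hf.smul_of_top_right hρ
  have hdiff : Integrable (fun x => (t x * f x - f x) / (1 + ν)) P := (htf.sub hf).div_const _
  have hσ : MemLp (fun x => (t x - 1) / (t x + ν) - (t x - 1) / (1 + ν)) ∞ P :=
    hρ.sub ((ht_top.sub (memLp_top_const 1)).mul_const (1 + ν)⁻¹)
  rw [← integral_sub htf hf, ← integral_div, ← integral_sub hρf hdiff]
  have heq (x : X) : (t x - 1) / (t x + ν) * f x - (t x * f x - f x) / (1 + ν) =
      ((t x - 1) / (t x + ν) - (t x - 1) / (1 + ν)) * f x := by ring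
  simp only [heq]
  refine abs_integral_le_integral_abs.trans ?_
  simp only [abs_mul, abs_of_nonneg (hf0 _)]
  exact integral_abs_mul_le hσ (ht.mono fun x hx => abs_sub_one_div_add_sub_le hν hδ hx) hf hf0

theorem exists_abs_varianceTerm_sub_meanTerm_le [IsProbabilityMeasure P] (hG : MemLp G 2 P)
    (hJ : IsUnit (secondMoment P G 1).det) (hcal : IsCenteredOrCalibrated P G) :
    ∃ C, ∃ r > 0, ∀ ρ : X → ℝ, AEStronglyMeasurable ρ P → ∀ δ ≤ r,
      (∀ᵐ x ∂P, |ρ x| ≤ δ) → IsUnit (secondMoment P G fun x => 1 - ρ x).det ∧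
        |varianceTerm P G (fun x => 1 - ρ x) - meanTerm P G (fun x => 1 - ρ x) -
          (varianceTerm P G 1 - meanTerm P G 1 + ∫ x, ρ x * ‖influence P G x‖ ^ 2 ∂P)| ≤
          C * δ ^ 2 := by
  obtain ⟨C₁, hC₁, r₁, hr₁, hV⟩ := exists_varianceTerm_one_sub_le hG hJ
  obtain ⟨C₂, hC₂, r₂, hr₂, hQ⟩ := exists_meanTerm_one_sub_le hG hJ hcal
  have hu := (memLp_influence hG).integrable_norm_pow two_ne_zero
  set τ := ∫ x, ‖influence P G x‖ ^ 2 ∂P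
  have : 0 ≤ τ := integral_nonneg fun x => sq_nonneg _
  refine ⟨C₁ * τ ^ 2 + C₂ * τ, min r₁ r₂ / (τ + 1), by positivity,
    fun ρ hρm δ hδ hρδ => ?_⟩
  have hρ : MemLp ρ ∞ P := memLp_top_of_bound hρm δ hρδ
  obtain ⟨x, hx⟩ := hρδ.exists
  have hδ0 : 0 ≤ δ := (abs_nonneg _).trans hx
  have hb0 : 0 ≤ ∫ x, |ρ x| ∂P := integral_nonneg fun x => abs_nonneg _
  have hb : ∫ x, |ρ x| ∂P ≤ δ := by
    simpa using integral_abs_mul_le hρ hρδ (integrable_const 1) fun _ => zero_le_one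
  have ha0 : 0 ≤ ∫ x, |ρ x| * ‖influence P G x‖ ^ 2 ∂P := integral_nonneg fun x => by positivity
  have ha : ∫ x, |ρ x| * ‖influence P G x‖ ^ 2 ∂P ≤ δ * τ :=
    integral_abs_mul_le hρ hρδ hu fun x => sq_nonneg _
  have har : ∫ x, |ρ x| * ‖influence P G x‖ ^ 2 ∂P ≤ min r₁ r₂ := by
    rw [le_div_iff₀ (by positivity)] at hδ
    linarith
  obtain ⟨hdet, -, hV⟩ := hV ρ hρ (har.trans (min_le_left _ _))
  have hQ := hQ ρ hρ (har.trans (min_le_right _ _))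
  refine ⟨hdet, ?_⟩
  calc _ = |(varianceTerm P G (fun x => 1 - ρ x) - varianceTerm P G 1 -
            ∫ x, ρ x * ‖influence P G x‖ ^ 2 ∂P) -
          (meanTerm P G (fun x => 1 - ρ x) - meanTerm P G 1)| := by congr 1; ring
    _ ≤ C₁ * (δ * τ) ^ 2 + C₂ * (δ * (δ * τ)) := by
        refine (abs_sub _ _).trans (add_le_add (hV.trans ?_) (hQ.trans ?_)) <;> gcongr
    _ = (C₁ * τ ^ 2 + C₂ * τ) * δ ^ 2 := by ring

theorem exists_abs_asymptoticMSE_sub_le [IsProbabilityMeasure P] (hG : MemLp G 2 P)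
    (hJ : IsUnit (secondMoment P G 1).det) (hcal : IsCenteredOrCalibrated P G) (T : ℝ) {ν : ℝ}
    (hν : 0 < ν) :
    ∃ C, ∃ δ₀ > 0, ∀ t : X → ℝ, AEMeasurable t P → ∀ δ ≤ δ₀, (∀ᵐ x ∂P, |t x - 1| ≤ δ) →
      ∫⁻ x, ENNReal.ofReal (t x * ‖influence P G x‖ ^ 2) ∂P ≠ ⊤ ∧
      |asymptoticMSE P G T ν (fun x => 1 - dataPosterior t ν x) -
        ((1 + ν) ^ 2 / (T * ν) * (varianceTerm P G 1 - meanTerm P G 1) + (1 + ν) / (T * ν) *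
          ((∫⁻ x, ENNReal.ofReal (t x * ‖influence P G x‖ ^ 2) ∂P).toReal - varianceTerm P G 1))|
        ≤ C * δ ^ 2 := by
  obtain ⟨C, r, hr, h⟩ := exists_abs_varianceTerm_sub_meanTerm_le hG hJ hcal
  have hu := (memLp_influence hG).integrable_norm_pow two_ne_zero
  refine ⟨|(1 + ν) ^ 2 / (T * ν)| * (4 * C + 2 * varianceTerm P G 1), min (1 / 2) (r / 2),
    by positivity, fun t htm δ hδ ht => ?_⟩
  have hδ₁ : δ ≤ 1 / 2 := hδ.trans (min_le_left _ _)
  have ht0 : ∀ᵐ x ∂P, 1 / 2 ≤ t x := ht.mono fun x hx => by linarith [(abs_le.1 hx).1]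
  have htu : Integrable (fun x => t x * ‖influence P G x‖ ^ 2) P :=
    integrable_mul_norm_sq (memLp_influence hG) (memLp_top_of_abs_sub_one_le htm ht)
  have htu0 : ∀ᵐ x ∂P, 0 ≤ t x * ‖influence P G x‖ ^ 2 :=
    ht0.mono fun x hx => mul_nonneg (by linarith) (sq_nonneg _)
  have hlin := abs_integral_sub_one_div_add_le htm hν hδ₁ ht hu fun x => sq_nonneg _
  obtain ⟨hdet, hquad⟩ := h _ (memLp_top_sub_one_div_add htm hν hδ₁ ht).1 (2 * δ)
    (by linarith [hδ.trans (min_le_right _ _)])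
    (ht.mono fun x hx => abs_sub_one_div_add_le hν hδ₁ hx)
  refine ⟨htu.lintegral_lt_top.ne, ?_⟩
  rw [← integral_eq_lintegral_of_nonneg_ae htu0 htu.1, asymptoticMSE_congr
    (ht0.mono fun x hx => .inr (one_sub_dataPosterior_eq hν (by linarith))),
    asymptoticMSE_const_mul hdet T hν]
  rw [← varianceTerm_one hG hJ] at hlin
  set V := varianceTerm P G 1
  set L := (∫ x, t x * ‖influence P G x‖ ^ 2 ∂P - V) / (1 + ν) with hL
  rw [show (1 + ν) / (T * ν) * (∫ x, t x * ‖influence P G x‖ ^ 2 ∂P - V) =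
    (1 + ν) ^ 2 / (T * ν) * L by rw [hL]; field_simp, ← mul_add, ← mul_sub, abs_mul, mul_assoc]
  gcongr
  refine (abs_sub_le _ _ _).trans ((add_le_add hquad ?_).trans_eq
    (by ring : C * (2 * δ) ^ 2 + 2 * δ ^ 2 * V = _))
  rwa [add_sub_add_left_eq_sub]

end NearData

section Divergence

theorem ofReal_sq_div_add_ofReal {q r : ℝ} (hq : 0 ≤ q) (hr : 0 < r) :
    ENNReal.ofReal q ^ 2 / ENNReal.ofReal r + ENNReal.ofReal r =
      ENNReal.ofReal (2 * q + (q - r) ^ 2 / r) := by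
  rw [← ENNReal.ofReal_pow hq, ← ENNReal.ofReal_div_of_pos hr,
    ← ENNReal.ofReal_add (by positivity) hr.le]
  congr 1
  field_simp
  ring

theorem two_mul_ofReal_le_sq_div_add {q r : ℝ} (hq : 0 ≤ q) (hr : 0 ≤ r) :
    2 * ENNReal.ofReal q ≤ ENNReal.ofReal q ^ 2 / ENNReal.ofReal r + ENNReal.ofReal r := by
  rcases hr.eq_or_lt with rfl | hr
  · rcases hq.eq_or_lt with rfl | hq
    · simp
    · simp [ENNReal.div_zero, hq]
  · rw [ofReal_sq_div_add_ofReal hq hr, ← ENNReal.ofReal_ofNat 2,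
      ← ENNReal.ofReal_mul zero_le_two]
    exact ENNReal.ofReal_le_ofReal (le_add_of_nonneg_right (by positivity))

theorem eq_of_two_mul_ofReal_eq {q r : ℝ} (hq : 0 ≤ q) (hr : 0 ≤ r)
    (h : 2 * ENNReal.ofReal q = ENNReal.ofReal q ^ 2 / ENNReal.ofReal r + ENNReal.ofReal r) :
    r = q := by
  rcases hr.eq_or_lt with rfl | hr
  · by_contra hne
    simp [ENNReal.div_zero, hq.lt_of_ne hne, ENNReal.mul_eq_top] at h
  · rw [ofReal_sq_div_add_ofReal hq hr, ← ENNReal.ofReal_ofNat 2,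
      ← ENNReal.ofReal_mul zero_le_two, ENNReal.ofReal_eq_ofReal_iff (by positivity)
        (by positivity), left_eq_add, div_eq_zero_iff, sq_eq_zero_iff, sub_eq_zero] at h
    exact (h.resolve_right hr.ne').symm

variable {X : Type*} [MeasurableSpace X] {μ : Measure X} {q r : X → ℝ}

theorem IsDensity.aemeasurable (hq : IsDensity μ q) : AEMeasurable q μ :=
  hq.integrable.aemeasurable

theorem IsDensity.lintegral_eq_one (hq : IsDensity μ q) : ∫⁻ x, ENNReal.ofReal (q x) ∂μ = 1 := by
  rw [← ofReal_integral_eq_lintegral_ofReal hq.integrable (.of_forall hq.nonneg),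
    hq.integral_eq_one, ENNReal.ofReal_one]

theorem lintegral_sq_div_add_ofReal (q : X → ℝ) (hr : IsDensity μ r) :
    ∫⁻ x, (ENNReal.ofReal (q x) ^ 2 / ENNReal.ofReal (r x) + ENNReal.ofReal (r x)) ∂μ =
      ∫⁻ x, ENNReal.ofReal (q x) ^ 2 / ENNReal.ofReal (r x) ∂μ + 1 := by
  rw [lintegral_add_right' _ hr.aemeasurable.ennreal_ofReal, hr.lintegral_eq_one]

theorem lintegral_two_mul_ofReal (hq : IsDensity μ q) :
    ∫⁻ x, 2 * ENNReal.ofReal (q x) ∂μ = 1 + 1 := by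
  rw [lintegral_const_mul' _ _ ENNReal.ofNat_ne_top, hq.lintegral_eq_one, mul_one,
    one_add_one_eq_two]

theorem one_le_lintegral_sq_div (hq : IsDensity μ q) (hr : IsDensity μ r) :
    1 ≤ ∫⁻ x, ENNReal.ofReal (q x) ^ 2 / ENNReal.ofReal (r x) ∂μ := by
  rw [← ENNReal.add_le_add_iff_right ENNReal.one_ne_top, ← lintegral_sq_div_add_ofReal q hr,
    ← lintegral_two_mul_ofReal hq]
  exact lintegral_mono fun x => two_mul_ofReal_le_sq_div_add (hq.nonneg x) (hr.nonneg x)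

theorem one_add_chiSq (hq : IsDensity μ q) (hr : IsDensity μ r) :
    1 + chiSq μ q r = ∫⁻ x, ENNReal.ofReal (q x) ^ 2 / ENNReal.ofReal (r x) ∂μ :=
  add_tsub_cancel_of_le (one_le_lintegral_sq_div hq hr)

theorem ae_eq_of_lintegral_sq_div_eq_one (hq : IsDensity μ q) (hr : IsDensity μ r)
    (h : ∫⁻ x, ENNReal.ofReal (q x) ^ 2 / ENNReal.ofReal (r x) ∂μ = 1) : r =ᵐ[μ] q := by
  have hsum := lintegral_sq_div_add_ofReal q hr
  rw [h, ← lintegral_two_mul_ofReal hq] at hsum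
  have hle : ∀ᵐ x ∂μ, 2 * ENNReal.ofReal (q x) ≤
      ENNReal.ofReal (q x) ^ 2 / ENNReal.ofReal (r x) + ENNReal.ofReal (r x) :=
    .of_forall fun x => two_mul_ofReal_le_sq_div_add (hq.nonneg x) (hr.nonneg x)
  have hfin : ∫⁻ x, 2 * ENNReal.ofReal (q x) ∂μ ≠ ⊤ := by
    rw [lintegral_two_mul_ofReal hq]
    finiteness
  have hmeas := (((hq.aemeasurable.ennreal_ofReal.pow_const 2).div
    hr.aemeasurable.ennreal_ofReal).add hr.aemeasurable.ennreal_ofReal)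
  filter_upwards [ae_eq_of_ae_le_of_lintegral_le hle hfin hmeas hsum.le] with x hx
  exact eq_of_two_mul_ofReal_eq (hq.nonneg x) (hr.nonneg x) hx

theorem chiSq_eq_zero_iff (hq : IsDensity μ q) (hr : IsDensity μ r) :
    chiSq μ q r = 0 ↔ r =ᵐ[μ] q := by
  rw [chiSq, tsub_eq_zero_iff_le]
  refine ⟨fun h => ae_eq_of_lintegral_sq_div_eq_one hq hr
    (h.antisymm (one_le_lintegral_sq_div hq hr)), fun h => ?_⟩
  calc ∫⁻ x, ENNReal.ofReal (q x) ^ 2 / ENNReal.ofReal (r x) ∂μ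
      ≤ ∫⁻ x, ENNReal.ofReal (q x) ∂μ := lintegral_mono_ae (h.mono fun x hx => by
        rw [hx, sq, mul_div_assoc]
        exact mul_le_of_le_one_right' ENNReal.div_self_le_one)
    _ = 1 := hq.lintegral_eq_one

/-- The law of the data, with density `pd` with respect to `μ`. -/
noncomputable abbrev dataMeasure (μ : Measure X) (pd : X → ℝ) : Measure X :=
  μ.withDensity fun x => ENNReal.ofReal (pd x)

variable {pd pn w : X → ℝ}

theorem isDensity_normProd (hpd : IsDensity μ pd) (hw : ∀ x, 0 ≤ w x)
    (hi : Integrable (fun x => pd x * w x) μ) (hZ : 0 < ∫ x, pd x * w x ∂μ) :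
    IsDensity μ (normProd μ pd w) where
  nonneg x := div_nonneg (mul_nonneg (hpd.nonneg x) (hw x)) hZ.le
  integrable := hi.div_const _
  integral_eq_one := by simp only [normProd, integral_div, div_self hZ.ne']

theorem ofReal_sq_mul_one_add_chiSq_normProd (hpd : IsDensity μ pd) (hpn : IsDensity μ pn)
    (hw : ∀ x, 0 ≤ w x) (hi : Integrable (fun x => pd x * w x) μ) (hZ : 0 < ∫ x, pd x * w x ∂μ)
    (hpos : ∀ᵐ x ∂μ, 0 < pd x → w x ≠ 0 → 0 < pn x) :
    ENNReal.ofReal ((∫ x, pd x * w x ∂μ) ^ 2) * (1 + chiSq μ (normProd μ pd w) pn) =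
      ∫⁻ x, ENNReal.ofReal (pd x / pn x * w x ^ 2) ∂dataMeasure μ pd := by
  rw [one_add_chiSq (isDensity_normProd hpd hw hi hZ) hpn, dataMeasure,
    lintegral_withDensity_eq_lintegral_mul_non_measurable₀ _ hpd.aemeasurable.ennreal_ofReal
      (.of_forall fun _ => ENNReal.ofReal_lt_top),
    ← lintegral_const_mul' _ _ ENNReal.ofReal_ne_top]
  refine lintegral_congr_ae ?_
  filter_upwards [hpos] with x hx
  simp only [Pi.mul_apply, normProd]
  rcases (hpd.nonneg x).eq_or_lt with hpd0 | hpd0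
  · simp [← hpd0]
  rcases (hw x).eq_or_lt with hw0 | hw0
  · simp [← hw0]
  have hpn0 := hx hpd0 hw0.ne'
  rw [← ENNReal.ofReal_pow (by positivity), ← ENNReal.ofReal_div_of_pos hpn0,
    ← ENNReal.ofReal_mul (by positivity), ← ENNReal.ofReal_mul hpd0.le]
  congr 1
  field_simp

end Divergence

section DataMeasure

variable {X : Type*} [MeasurableSpace X] {μ : Measure X} {pd : X → ℝ}

theorem IsDensity.isProbabilityMeasure (hpd : IsDensity μ pd) :
    IsProbabilityMeasure (dataMeasure μ pd) := by
  refine ⟨?_⟩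
  rw [withDensity_apply _ MeasurableSet.univ, Measure.restrict_univ, hpd.lintegral_eq_one]

theorem IsDensity.ae_dataMeasure_iff (hpd : IsDensity μ pd) {s : X → Prop} :
    (∀ᵐ x ∂dataMeasure μ pd, s x) ↔ ∀ᵐ x ∂μ, 0 < pd x → s x := by
  simp only [dataMeasure, ae_withDensity_iff' hpd.aemeasurable.ennreal_ofReal, ne_eq,
    ENNReal.ofReal_eq_zero, not_le]

variable {E : Type*} [NormedAddCommGroup E] [NormedSpace ℝ E]

theorem IsDensity.integral_dataMeasure (hpd : IsDensity μ pd) (f : X → E) :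
    ∫ x, f x ∂dataMeasure μ pd = ∫ x, pd x • f x ∂μ := by
  rw [dataMeasure, integral_withDensity_eq_integral_toReal_smul₀ hpd.aemeasurable.ennreal_ofReal
    (.of_forall fun _ => ENNReal.ofReal_lt_top)]
  simp only [ENNReal.toReal_ofReal (hpd.nonneg _)]

theorem IsDensity.integrable_dataMeasure_iff (hpd : IsDensity μ pd) {f : X → E} :
    Integrable f (dataMeasure μ pd) ↔ Integrable (fun x => pd x • f x) μ := by
  rw [dataMeasure, integrable_withDensity_iff_integrable_smul₀' hpd.aemeasurable.ennreal_ofReal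
    (.of_forall fun _ => ENNReal.ofReal_lt_top)]
  simp only [ENNReal.toReal_ofReal (hpd.nonneg _)]

end DataMeasure

section Model

variable {X ι : Type*} [Fintype ι] {p : EuclideanSpace ℝ ι → X → ℝ} {β₀ : EuclideanSpace ℝ ι}

theorem hasFDerivAt_innerSL_smul_score {x : X} (h0 : ∀ᶠ β in 𝓝 β₀, 0 ≤ p β x)
    (hd : DifferentiableAt ℝ (fun β => p β x) β₀) :
    HasFDerivAt (fun β => p β x) (innerSL ℝ (p β₀ x • score p β₀ x)) β₀ := by
  suffices h : innerSL ℝ (p β₀ x • score p β₀ x) = fderiv ℝ (fun β => p β x) β₀ from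
    h ▸ hd.hasFDerivAt
  rcases h0.self_of_nhds.eq_or_lt with hx | hx
  · have hmin : IsLocalMin (fun β => p β x) β₀ := by simpa only [IsLocalMin, IsMinFilter, ← hx]
    rw [hmin.fderiv_eq_zero, ← hx, zero_smul, map_zero]
  · ext v
    rw [innerSL_apply_apply, real_inner_smul_left, score, inner_gradient_left,
      fderiv.log hd hx.ne', _root_.smul_apply, smul_eq_mul, mul_inv_cancel_left₀ hx.ne']

theorem IsUnnormalizedModel.exists_eventuallyEq_mul_exp (h : IsUnnormalizedModel p β₀) :
    ∃ v, ∀ x, (fun s : ℝ => p (β₀ + s • v) x) =ᶠ[𝓝 0] fun s => p β₀ x * Real.exp s := by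
  classical
  obtain ⟨j, q, hq⟩ := h
  refine ⟨-EuclideanSpace.single j 1, fun x => ?_⟩
  have hline : Tendsto (fun s : ℝ => β₀ + s • -EuclideanSpace.single j (1 : ℝ)) (𝓝 0) (𝓝 β₀) :=
    Continuous.tendsto' (by fun_prop) _ _ (by simp)
  filter_upwards [hline.eventually hq] with s hs
  have hθ : (fun i : {i : ι // i ≠ j} => (β₀ + s • -EuclideanSpace.single j (1 : ℝ)) i) =
      fun i : {i : ι // i ≠ j} => β₀ i := by
    ext i
    simp [i.2]
  have hc : (β₀ + s • -EuclideanSpace.single j (1 : ℝ)) j = β₀ j - s := by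
    simp [sub_eq_add_neg]
  rw [hs x, hq.self_of_nhds x, hθ, hc, Real.exp_sub, div_div_eq_mul_div, div_mul_eq_mul_div]

theorem IsUnnormalizedModel.exists_inner_score_eq_one (h : IsUnnormalizedModel p β₀)
    (h0 : ∀ᶠ β in 𝓝 β₀, ∀ x, 0 ≤ p β x) :
    ∃ v, ∀ x, 0 < p β₀ x → DifferentiableAt ℝ (fun β => p β x) β₀ → ⟪score p β₀ x, v⟫ = 1 := by
  obtain ⟨v, hv⟩ := h.exists_eventuallyEq_mul_exp
  refine ⟨v, fun x hx hd => ?_⟩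
  have hexp : HasLineDerivAt ℝ (fun β => p β x) (p β₀ x) β₀ v :=
    HasDerivAt.congr_of_eventuallyEq
      (by simpa using (Real.hasDerivAt_exp 0).const_mul (p β₀ x)) (hv x)
  have hscore := (hasFDerivAt_innerSL_smul_score (h0.mono fun β hβ => hβ x) hd).hasLineDerivAt v
  have heq := hscore.unique hexp
  rw [innerSL_apply_apply, real_inner_smul_left] at heq
  exact (mul_eq_left₀ hx.ne').1 heq

variable [MeasurableSpace X] {μ : Measure X}

theorem IsNormalizedModel.integral_smul_score_eq_zero (h : IsNormalizedModel μ p β₀)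
    (h0 : ∀ᶠ β in 𝓝 β₀, ∀ x, 0 ≤ p β x) (hint : ∀ᶠ β in 𝓝 β₀, Integrable (p β) μ)
    (hs : Integrable (fun x => p β₀ x • score p β₀ x) μ) :
    ∫ x, p β₀ x • score p β₀ x ∂μ = 0 := by
  obtain ⟨r, hr, B, hB, hdom⟩ := h.dominated
  have hscore := (innerSL ℝ (E := EuclideanSpace ℝ ι)).integrable_comp hs
  obtain ⟨-, hder⟩ := hasFDerivAt_integral_of_dominated_loc_of_lip'
    (F := fun β x => p β x) (s := Metric.ball β₀ r ∩ {β | Integrable (p β) μ})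
    (inter_mem (Metric.ball_mem_nhds _ hr) hint) (fun β hβ => hβ.2.aestronglyMeasurable)
    hint.self_of_nhds hscore.aestronglyMeasurable (hdom.mono fun x hx β hβ => hx β hβ.1) hB
    (h.differentiableAt.mono fun x hx =>
      hasFDerivAt_innerSL_smul_score (h0.mono fun β hβ => hβ x) hx)
  have hconst : HasFDerivAt (fun β => ∫ x, p β x ∂μ) (0 : EuclideanSpace ℝ ι →L[ℝ] ℝ) β₀ :=
    (hasFDerivAt_const (1 : ℝ) β₀).congr_of_eventuallyEq h.integral_eq_one
  have heq := hder.unique hconst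
  rw [ContinuousLinearMap.integral_comp_comm _ hs] at heq
  exact innerSL_inj.1 (heq.trans (map_zero _).symm)

theorem IsRegularModel.isCenteredOrCalibrated [DecidableEq ι] (hreg : IsRegularModel μ p β₀)
    (hmodel : IsNormalizedModel μ p β₀ ∨ IsUnnormalizedModel p β₀) :
    IsCenteredOrCalibrated (dataMeasure μ (p β₀)) (score p β₀) := by
  have hpd := hreg.isDensity
  have := hpd.isProbabilityMeasure
  rcases hmodel with h | h
  · left
    simp only [firstMoment, Pi.one_apply, one_smul, hpd.integral_dataMeasure]
    exact h.integral_smul_score_eq_zero hreg.nonneg hreg.integrable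
      (hpd.integrable_dataMeasure_iff.1 (hreg.memLp_score.integrable one_le_two))
  · right
    obtain ⟨v, hv⟩ := h.exists_inner_score_eq_one hreg.nonneg
    exact ⟨v, hpd.ae_dataMeasure_iff.2 (hreg.differentiableAt.mono fun x hd hx => hv x hx (hd hx))⟩

end Model

section RegularScore

theorem metricNorm_pow_two {ι : Type*} [Fintype ι] [DecidableEq ι] {A : Matrix ι ι ℝ}
    (hA : A.IsSymm) (v : EuclideanSpace ℝ ι) :
    metricNorm (A ^ 2) v = ‖toEuclideanCLM (𝕜 := ℝ) A v‖ := by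
  have h : v.ofLp ⬝ᵥ (A ^ 2 *ᵥ v.ofLp) = (A *ᵥ v.ofLp) ⬝ᵥ (A *ᵥ v.ofLp) := by
    rw [sq, ← mulVec_mulVec, dotProduct_mulVec, ← mulVec_transpose, hA.eq]
  rw [metricNorm, h, EuclideanSpace.norm_eq, dotProduct]
  simp_rw [Real.norm_eq_abs, sq_abs, sq, ofLp_toEuclideanCLM]

theorem noisePosterior_eq_one_sub_dataPosterior {X : Type*} {pd pn : X → ℝ} {x : X} {ν : ℝ}
    (hpd : 0 ≤ pd x) (hpn : 0 < pn x) (hν : 0 < ν) :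
    noisePosterior pd pn ν x = 1 - dataPosterior (fun x => pd x / pn x) ν x := by
  have : 0 < pd x + ν * pn x := by positivity
  rw [noisePosterior, dataPosterior]
  field_simp
  ring

variable {X ι : Type*} [MeasurableSpace X] {μ : Measure X} {pd pn w : X → ℝ}

theorem memLp_noisePosterior (hpd : IsDensity μ pd) (hpn : IsDensity μ pn) {ν : ℝ}
    (hν : 0 ≤ ν) : MemLp (noisePosterior pd pn ν) ∞ (dataMeasure μ pd) := by
  have hm : AEMeasurable (noisePosterior pd pn ν) μ :=
    (hpn.aemeasurable.const_mul ν).div (hpd.aemeasurable.add (hpn.aemeasurable.const_mul ν))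
  refine memLp_top_of_bound
    (hm.mono_ac (withDensity_absolutelyContinuous _ _)).aestronglyMeasurable 1
    (.of_forall fun x => ?_)
  have := hpd.nonneg x
  have := hpn.nonneg x
  rw [noisePosterior, Real.norm_of_nonneg (by positivity)]
  exact div_le_one_of_le₀ (le_add_of_nonneg_left ‹_›) (by positivity)

/-- The noise densities for which the error is well defined: those that are positive wherever
the data carries information on the parameter. -/
def IsAdmissible (μ : Measure X) (pd : X → ℝ) (g : X → EuclideanSpace ℝ ι) (pn : X → ℝ) : Prop :=
  IsDensity μ pn ∧ ∀ᵐ x ∂μ, 0 < pd x → g x ≠ 0 → 0 < pn x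

variable [Fintype ι] [DecidableEq ι]

/-- A data density `pd` together with a score `g` whose Fisher information is finite and
invertible. The expansions of the error use nothing else about the model, apart from
`IsCenteredOrCalibrated`. -/
structure IsRegularScore (μ : Measure X) (pd : X → ℝ) (g : X → EuclideanSpace ℝ ι) : Prop where
  isDensity : IsDensity μ pd
  memLp : MemLp g 2 (dataMeasure μ pd)
  isUnit_det_fisher : IsUnit (fisher μ pd g).det

theorem IsRegularModel.isRegularScore {p : EuclideanSpace ℝ ι → X → ℝ} {β₀ : EuclideanSpace ℝ ι}
    (hreg : IsRegularModel μ p β₀) : IsRegularScore μ (p β₀) (score p β₀) :=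
  ⟨hreg.isDensity, hreg.memLp_score, hreg.isUnit_det_fisher⟩

/-- The weight `‖g(x)‖_{I⁻²}` by which the optimal noise tilts the data density. -/
noncomputable def optimalWeight (μ : Measure X) (pd : X → ℝ) (g : X → EuclideanSpace ℝ ι)
    (x : X) : ℝ :=
  metricNorm ((fisher μ pd g)⁻¹ ^ 2) (g x)

theorem optimalWeight_nonneg (μ : Measure X) (pd : X → ℝ) (g : X → EuclideanSpace ℝ ι) (x : X) :
    0 ≤ optimalWeight μ pd g x :=
  Real.sqrt_nonneg _

/-- The optimal noise density `pd • w₁`, where `w₁` is the optimal weight. -/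
noncomputable def optimalNoise (μ : Measure X) (pd : X → ℝ) (g : X → EuclideanSpace ℝ ι) :
    X → ℝ :=
  normProd μ pd (optimalWeight μ pd g)

namespace IsRegularScore

variable {g : X → EuclideanSpace ℝ ι} (h : IsRegularScore μ pd g)
include h

theorem scoreCov_eq_secondMoment (hw : MemLp w ∞ (dataMeasure μ pd)) :
    scoreCov μ pd g w = secondMoment (dataMeasure μ pd) g w := by
  ext i j
  rw [secondMoment_apply h.memLp hw, h.isDensity.integral_dataMeasure]
  simp only [scoreCov, of_apply, smul_eq_mul, mul_comm (pd _)]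

theorem scoreMean_eq_firstMoment (hw : MemLp w ∞ (dataMeasure μ pd)) :
    scoreMean μ pd g w = (firstMoment (dataMeasure μ pd) g w).ofLp := by
  have := h.isDensity.isProbabilityMeasure
  ext i
  rw [firstMoment, eval_integral_piLp fun i => (integrable_smul h.memLp hw).eval_piLp i,
    h.isDensity.integral_dataMeasure]
  simp only [scoreMean, PiLp.smul_apply, smul_eq_mul, mul_comm (pd _)]

theorem fisher_eq_secondMoment : fisher μ pd g = secondMoment (dataMeasure μ pd) g 1 :=
  h.scoreCov_eq_secondMoment (memLp_top_const 1)

theorem isUnit_det_secondMoment_one : IsUnit (secondMoment (dataMeasure μ pd) g 1).det :=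
  h.fisher_eq_secondMoment ▸ h.isUnit_det_fisher

theorem trace_inv_scoreCov (hw : MemLp w ∞ (dataMeasure μ pd)) :
    (scoreCov μ pd g w)⁻¹.trace = varianceTerm (dataMeasure μ pd) g w := by
  rw [varianceTerm, h.scoreCov_eq_secondMoment hw]

theorem trace_inv_scoreCov_mul_vecMulVec_mul (hw : MemLp w ∞ (dataMeasure μ pd)) :
    ((scoreCov μ pd g w)⁻¹ * vecMulVec (scoreMean μ pd g w) (scoreMean μ pd g w) *
      (scoreCov μ pd g w)⁻¹).trace = meanTerm (dataMeasure μ pd) g w := by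
  rw [h.scoreMean_eq_firstMoment hw, h.scoreCov_eq_secondMoment hw, meanTerm,
    trace_mul_vecMulVec_mul (secondMoment_isSymm h.memLp hw).inv]

theorem optimalWeight_eq_norm_influence :
    optimalWeight μ pd g = fun x => ‖influence (dataMeasure μ pd) g x‖ := by
  ext x
  rw [optimalWeight, h.fisher_eq_secondMoment,
    metricNorm_pow_two (isSymm_inv_secondMoment_one h.memLp), influence]

theorem optimalWeight_eq_zero_iff {x : X} : optimalWeight μ pd g x = 0 ↔ g x = 0 := by
  rw [h.optimalWeight_eq_norm_influence, norm_eq_zero]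
  refine ⟨fun hx => ?_, fun hx => by rw [influence, hx, map_zero]⟩
  rw [← toEuclideanCLM_secondMoment_influence h.isUnit_det_secondMoment_one x, hx, map_zero]

theorem integrable_optimalWeight : Integrable (optimalWeight μ pd g) (dataMeasure μ pd) := by
  have := h.isDensity.isProbabilityMeasure
  rw [h.optimalWeight_eq_norm_influence]
  exact ((memLp_influence h.memLp).integrable one_le_two).norm

theorem integrable_mul_optimalWeight : Integrable (fun x => pd x * optimalWeight μ pd g x) μ :=
  h.isDensity.integrable_dataMeasure_iff.1 h.integrable_optimalWeight

theorem integral_mul_optimalWeight_pos [Nonempty ι] :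
    0 < ∫ x, pd x * optimalWeight μ pd g x ∂μ := by
  simp only [← smul_eq_mul, ← h.isDensity.integral_dataMeasure]
  refine (integral_nonneg (optimalWeight_nonneg μ pd g)).lt_of_ne' fun hzero => ?_
  rw [integral_eq_zero_iff_of_nonneg (optimalWeight_nonneg μ pd g)
    h.integrable_optimalWeight] at hzero
  have hI : secondMoment (dataMeasure μ pd) g 1 = 0 := by
    rw [secondMoment_congr (w' := fun _ => 0)
      (hzero.mono fun x hx => .inl (h.optimalWeight_eq_zero_iff.1 hx))]
    simp only [secondMoment, zero_smul, integral_zero]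
  simpa only [hI, det_zero, isUnit_zero_iff, zero_ne_one] using h.isUnit_det_secondMoment_one

theorem optimalNoise_apply (x : X) :
    optimalNoise μ pd g x = pd x * ‖WithLp.toLp 2 ((fisher μ pd g)⁻¹ *ᵥ (g x).ofLp)‖ /
      ∫ y, pd y * ‖WithLp.toLp 2 ((fisher μ pd g)⁻¹ *ᵥ (g y).ofLp)‖ ∂μ := by
  rw [optimalNoise, h.optimalWeight_eq_norm_influence, h.fisher_eq_secondMoment]
  rfl

theorem isAdmissible_optimalNoise [Nonempty ι] : IsAdmissible μ pd g (optimalNoise μ pd g) := by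
  refine ⟨isDensity_normProd h.isDensity (optimalWeight_nonneg μ pd g)
    h.integrable_mul_optimalWeight h.integral_mul_optimalWeight_pos, .of_forall fun x hx hg => ?_⟩
  have hw : 0 < optimalWeight μ pd g x :=
    (optimalWeight_nonneg μ pd g x).lt_of_ne' (h.optimalWeight_eq_zero_iff.not.2 hg)
  exact div_pos (mul_pos hx hw) h.integral_mul_optimalWeight_pos

theorem ofReal_sq_mul_one_add_chiSq [Nonempty ι] (hpn : IsAdmissible μ pd g pn) :
    ENNReal.ofReal ((∫ x, pd x * optimalWeight μ pd g x ∂μ) ^ 2) *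
        (1 + chiSq μ (optimalNoise μ pd g) pn) =
      ∫⁻ x, ENNReal.ofReal (pd x / pn x * ‖influence (dataMeasure μ pd) g x‖ ^ 2)
        ∂dataMeasure μ pd := by
  have hpos : ∀ᵐ x ∂μ, 0 < pd x → optimalWeight μ pd g x ≠ 0 → 0 < pn x :=
    hpn.2.mono fun x hx hpd hw => hx hpd (h.optimalWeight_eq_zero_iff.not.1 hw)
  rw [optimalNoise, ofReal_sq_mul_one_add_chiSq_normProd h.isDensity hpn.1
    (optimalWeight_nonneg μ pd g) h.integrable_mul_optimalWeight
    h.integral_mul_optimalWeight_pos hpos, h.optimalWeight_eq_norm_influence]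

theorem lintegral_eq_top_iff_chiSq_eq_top [Nonempty ι] (hpn : IsAdmissible μ pd g pn) :
    ∫⁻ x, ENNReal.ofReal (pd x / pn x * ‖influence (dataMeasure μ pd) g x‖ ^ 2)
      ∂dataMeasure μ pd = ⊤ ↔ chiSq μ (optimalNoise μ pd g) pn = ⊤ := by
  have hZ := h.integral_mul_optimalWeight_pos.ne'
  rw [← h.ofReal_sq_mul_one_add_chiSq hpn, ENNReal.mul_eq_top]
  simp [hZ]

theorem toReal_lintegral_eq_sq_mul_one_add_chiSq [Nonempty ι] (hpn : IsAdmissible μ pd g pn)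
    (hfin : chiSq μ (optimalNoise μ pd g) pn ≠ ⊤) :
    (∫⁻ x, ENNReal.ofReal (pd x / pn x * ‖influence (dataMeasure μ pd) g x‖ ^ 2)
      ∂dataMeasure μ pd).toReal =
        (∫ x, pd x * optimalWeight μ pd g x ∂μ) ^ 2 *
          (1 + (chiSq μ (optimalNoise μ pd g) pn).toReal) := by
  rw [← h.ofReal_sq_mul_one_add_chiSq hpn, ENNReal.toReal_mul,
    ENNReal.toReal_ofReal (sq_nonneg _), ENNReal.toReal_add ENNReal.one_ne_top hfin,
    ENNReal.toReal_one]

theorem isUnit_det_scoreCov_noisePosterior (hpn : IsAdmissible μ pd g pn) {ν : ℝ} (hν : 0 < ν) :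
    IsUnit (scoreCov μ pd g (noisePosterior pd pn ν)).det := by
  have hw := memLp_noisePosterior h.isDensity hpn.1 hν.le
  rw [h.scoreCov_eq_secondMoment hw]
  refine isUnit_det_secondMoment h.memLp h.isUnit_det_secondMoment_one hw
    (h.isDensity.ae_dataMeasure_iff.2 (hpn.2.mono fun x hx hpd hg => ?_))
  have := hx hpd hg
  exact div_pos (by positivity) (by positivity)

theorem mse_eq_asymptoticMSE (hpn : IsAdmissible μ pd g pn) (T : ℝ) {ν : ℝ} (hν : 0 < ν) :
    mse μ pd g T ν pn = asymptoticMSE (dataMeasure μ pd) g T ν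
      fun x => 1 - dataPosterior (fun x => pd x / pn x) ν x := by
  have hw := memLp_noisePosterior h.isDensity hpn.1 hν.le
  have hposterior : ∀ᵐ x ∂dataMeasure μ pd, g x = 0 ∨
      noisePosterior pd pn ν x = 1 - dataPosterior (fun x => pd x / pn x) ν x :=
    h.isDensity.ae_dataMeasure_iff.2 (hpn.2.mono fun x hx hpd => or_iff_not_imp_left.2 fun hg =>
      noisePosterior_eq_one_sub_dataPosterior hpd.le (hx hpd hg) hν)
  rw [← asymptoticMSE_congr hposterior, mse, trace_sub, trace_smul, h.trace_inv_scoreCov hw,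
    h.trace_inv_scoreCov_mul_vecMulVec_mul hw, asymptoticMSE, smul_eq_mul]

theorem aemeasurable_div (hpn : IsDensity μ pn) :
    AEMeasurable (fun x => pd x / pn x) (dataMeasure μ pd) :=
  (h.isDensity.aemeasurable.div hpn.aemeasurable).mono_ac (withDensity_absolutelyContinuous _ _)

theorem chiSq_optimalNoise_eq_zero_iff [Nonempty ι] (hpn : IsDensity μ pn) :
    chiSq μ (optimalNoise μ pd g) pn = 0 ↔ pn =ᵐ[μ] optimalNoise μ pd g :=
  chiSq_eq_zero_iff h.isAdmissible_optimalNoise.1 hpn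

variable [Nonempty ι] (hcal : IsCenteredOrCalibrated (dataMeasure μ pd) g)
include hcal

theorem tendsto_mse_sub (hpn : IsAdmissible μ pd g pn)
    (hfin : chiSq μ (optimalNoise μ pd g) pn ≠ ⊤) (T : ℝ) :
    Tendsto (fun ν => mse μ pd g T ν pn - ν / T * (varianceTerm (dataMeasure μ pd) g 1 -
        meanTerm (dataMeasure μ pd) g 1)) atTop
      (𝓝 (1 / T * (varianceTerm (dataMeasure μ pd) g 1 - 2 * meanTerm (dataMeasure μ pd) g 1 +
        (∫ x, pd x * optimalWeight μ pd g x ∂μ) ^ 2 *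
          (1 + (chiSq μ (optimalNoise μ pd g) pn).toReal)))) := by
  have := h.isDensity.isProbabilityMeasure
  have hlim := tendsto_asymptoticMSE_sub h.memLp h.isUnit_det_secondMoment_one hcal
    (fun x => div_nonneg (h.isDensity.nonneg x) (hpn.1.nonneg x)) (h.aemeasurable_div hpn.1) T
    ((h.lintegral_eq_top_iff_chiSq_eq_top hpn).not.2 hfin)
  rw [h.toReal_lintegral_eq_sq_mul_one_add_chiSq hpn hfin] at hlim
  refine hlim.congr' ?_
  filter_upwards [eventually_gt_atTop 0] with ν hν
  rw [h.mse_eq_asymptoticMSE hpn T hν]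

theorem tendsto_mse_sub_atTop (hpn : IsAdmissible μ pd g pn)
    (hinf : chiSq μ (optimalNoise μ pd g) pn = ⊤) {T : ℝ} (hT : 0 < T) :
    Tendsto (fun ν => mse μ pd g T ν pn - ν / T * (varianceTerm (dataMeasure μ pd) g 1 -
        meanTerm (dataMeasure μ pd) g 1)) atTop atTop := by
  have := h.isDensity.isProbabilityMeasure
  have hlim := tendsto_asymptoticMSE_sub_atTop h.memLp h.isUnit_det_secondMoment_one hcal
    (fun x => div_nonneg (h.isDensity.nonneg x) (hpn.1.nonneg x)) (h.aemeasurable_div hpn.1) hT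
    ((h.lintegral_eq_top_iff_chiSq_eq_top hpn).2 hinf)
  refine hlim.congr' ?_
  filter_upwards [eventually_gt_atTop 0] with ν hν
  rw [h.mse_eq_asymptoticMSE hpn T hν]

theorem eventually_mse_optimalNoise_lt (hpn : IsAdmissible μ pd g pn)
    (hne : ¬ pn =ᵐ[μ] optimalNoise μ pd g) {T : ℝ} (hT : 0 < T) :
    ∀ᶠ ν in atTop, mse μ pd g T ν (optimalNoise μ pd g) < mse μ pd g T ν pn := by
  have hopt := h.isAdmissible_optimalNoise
  have hzero := (h.chiSq_optimalNoise_eq_zero_iff hopt.1).2 (ae_eq_refl _)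
  have hlim := h.tendsto_mse_sub hcal hopt (hzero ▸ ENNReal.zero_ne_top) T
  by_cases hfin : chiSq μ (optimalNoise μ pd g) pn = ⊤
  · have htop := h.tendsto_mse_sub_atTop hcal hpn hfin hT
    filter_upwards [(htop.atTop_add hlim.neg).eventually_gt_atTop 0] with ν hν
    linarith
  · have hpos : 0 < (chiSq μ (optimalNoise μ pd g) pn).toReal :=
      ENNReal.toReal_pos ((h.chiSq_optimalNoise_eq_zero_iff hpn.1).not.2 hne) hfin
    have hK := h.integral_mul_optimalWeight_pos
    rw [hzero, ENNReal.toReal_zero] at hlim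
    filter_upwards [hlim.eventually_lt (h.tendsto_mse_sub hcal hpn hfin T) (by gcongr)] with ν hν
    linarith

theorem exists_abs_mse_sub_le (T : ℝ) {ν : ℝ} (hν : 0 < ν) :
    ∃ C, ∃ δ₀ > 0, ∀ pn, IsDensity μ pn → ∀ (ε : X → ℝ) (δ : ℝ), δ ≤ δ₀ →
      (∀ᵐ x ∂μ, pd x = (1 + ε x) * pn x ∧ |ε x| ≤ δ) →
        chiSq μ (optimalNoise μ pd g) pn ≠ ⊤ ∧
        |mse μ pd g T ν pn - ((1 + ν) ^ 2 / (T * ν) * (varianceTerm (dataMeasure μ pd) g 1 -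
            meanTerm (dataMeasure μ pd) g 1) +
          (1 + ν) / (T * ν) * ((∫ x, pd x * optimalWeight μ pd g x ∂μ) ^ 2 *
            (1 + (chiSq μ (optimalNoise μ pd g) pn).toReal) -
              varianceTerm (dataMeasure μ pd) g 1))| ≤ C * δ ^ 2 := by
  have := h.isDensity.isProbabilityMeasure
  obtain ⟨C, δ₀, hδ₀, hC⟩ :=
    exists_abs_asymptoticMSE_sub_le h.memLp h.isUnit_det_secondMoment_one hcal T hν
  refine ⟨C, δ₀, hδ₀, fun pn hpn ε δ hδ hε => ?_⟩
  have hpos : ∀ᵐ x ∂μ, 0 < pd x → 0 < pn x := hε.mono fun x hx hpd =>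
    (hpn.nonneg x).lt_of_ne' fun hzero => by simp [hx.1, hzero] at hpd
  have hadm : IsAdmissible μ pd g pn := ⟨hpn, hpos.mono fun x hx hpd _ => hx hpd⟩
  have hratio : ∀ᵐ x ∂dataMeasure μ pd, |pd x / pn x - 1| ≤ δ := by
    rw [h.isDensity.ae_dataMeasure_iff]
    filter_upwards [hε, hpos] with x hx hpn0 hpd0
    rw [hx.1, mul_div_cancel_right₀ _ (hpn0 hpd0).ne', add_sub_cancel_left]
    exact hx.2
  obtain ⟨hfin, hle⟩ := hC _ (h.aemeasurable_div hpn) δ hδ hratio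
  rw [ne_eq, h.lintegral_eq_top_iff_chiSq_eq_top hadm] at hfin
  rw [h.toReal_lintegral_eq_sq_mul_one_add_chiSq hadm hfin,
    ← h.mse_eq_asymptoticMSE hadm T hν] at hle
  exact ⟨hfin, hle⟩

end IsRegularScore

end RegularScore

end NCE

theorem theorem1 {X : Type*} [MeasurableSpace X] (μ : Measure X)
    {ι : Type*} [Fintype ι] [DecidableEq ι] [Nonempty ι]
    (p : EuclideanSpace ℝ ι → X → ℝ) (β₀ : EuclideanSpace ℝ ι)
    (hreg : NCE.IsRegularModel μ p β₀)
    (hmodel : NCE.IsNormalizedModel μ p β₀ ∨ NCE.IsUnnormalizedModel p β₀)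
    (T : ℝ) (hT : 0 < T) :
    let pd : X → ℝ := p β₀
    let g : X → EuclideanSpace ℝ ι := NCE.score p β₀
    let I : Matrix ι ι ℝ := NCE.fisher μ pd g
    let m : ι → ℝ := NCE.scoreMean μ pd g (fun _ => 1)
    let M : Matrix ι ι ℝ := I⁻¹ * Matrix.vecMulVec m m * I⁻¹
    let w₁ : X → ℝ := fun x => NCE.metricNorm (I⁻¹ ^ 2) (g x)
    let K : ℝ := (∫ x, pd x * w₁ x ∂μ) ^ 2
    let popt : X → ℝ := NCE.normProd μ pd w₁
    let D : (X → ℝ) → ENNReal := fun pn => NCE.chiSq μ popt pn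
    let Admissible : (X → ℝ) → Prop := fun pn =>
      NCE.IsDensity μ pn ∧ ∀ᵐ x ∂μ, 0 < pd x → g x ≠ 0 → 0 < pn x
    -- the optimal noise is an admissible density, proportional to `pd * ‖I⁻¹ g‖`
    (0 < K ∧ Admissible popt ∧
      ∀ x, popt x = pd x * ‖WithLp.toLp 2 (I⁻¹ *ᵥ (g x).ofLp)‖ /
        ∫ y, pd y * ‖WithLp.toLp 2 (I⁻¹ *ᵥ (g y).ofLp)‖ ∂μ) ∧
    -- for an admissible noise the matrix `I_w` in the error is invertible
    (∀ pn, Admissible pn → ∀ ν : ℝ, 0 < ν →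
      IsUnit (NCE.scoreCov μ pd g (NCE.noisePosterior pd pn ν)).det) ∧
    -- expansion of the error up to `o(1)` in the all-noise limit
    (∀ pn, Admissible pn → D pn ≠ ⊤ →
      Tendsto (fun ν : ℝ => NCE.mse μ pd g T ν pn - ν / T * (I⁻¹ - M).trace) atTop
        (𝓝 (1 / T * ((I⁻¹ - (2 : ℝ) • M).trace + K * (1 + (D pn).toReal))))) ∧
    (∀ pn, Admissible pn → D pn = ⊤ →
      Tendsto (fun ν : ℝ => NCE.mse μ pd g T ν pn - ν / T * (I⁻¹ - M).trace) atTop atTop) ∧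
    -- the optimal noise is the unique minimizer of the divergence over all densities
    (∀ pn, NCE.IsDensity μ pn → (D pn = 0 ↔ pn =ᵐ[μ] popt)) ∧
    -- and it beats every other admissible noise in the all-noise limit
    (∀ pn, Admissible pn → ¬ pn =ᵐ[μ] popt →
      ∀ᶠ ν : ℝ in atTop, NCE.mse μ pd g T ν popt < NCE.mse μ pd g T ν pn) ∧
    -- first-order expansion, at fixed `ν`, for noise close to the data, `pd / pn = 1 + ε`
    (∀ ν : ℝ, 0 < ν → ∃ C : ℝ, ∃ δ₀ > 0, ∀ pn : X → ℝ, NCE.IsDensity μ pn →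
      ∀ (ε : X → ℝ) (δ : ℝ), δ ≤ δ₀ → (∀ᵐ x ∂μ, pd x = (1 + ε x) * pn x ∧ |ε x| ≤ δ) →
        D pn ≠ ⊤ ∧
        |NCE.mse μ pd g T ν pn -
          ((1 + ν) ^ 2 / (T * ν) * (I⁻¹ - M).trace +
            (1 + ν) / (T * ν) * (K * (1 + (D pn).toReal) - I⁻¹.trace))| ≤ C * δ ^ 2) := by
  intro pd g I m M w₁ K popt D Admissible
  have h : NCE.IsRegularScore μ pd g := hreg.isRegularScore
  have hcal := hreg.isCenteredOrCalibrated hmodel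
  have hI : I⁻¹.trace = NCE.varianceTerm (NCE.dataMeasure μ pd) g 1 :=
    h.trace_inv_scoreCov (memLp_top_const 1)
  have hM : M.trace = NCE.meanTerm (NCE.dataMeasure μ pd) g 1 :=
    h.trace_inv_scoreCov_mul_vecMulVec_mul (memLp_top_const 1)
  simp only [trace_sub, trace_smul, smul_eq_mul, hI, hM]
  exact ⟨⟨pow_pos h.integral_mul_optimalWeight_pos 2, h.isAdmissible_optimalNoise,
      h.optimalNoise_apply⟩,
    fun pn hpn ν hν => h.isUnit_det_scoreCov_noisePosterior hpn hν,
    fun pn hpn hfin => h.tendsto_mse_sub hcal hpn hfin T,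
    fun pn hpn hinf => h.tendsto_mse_sub_atTop hcal hpn hinf hT,
    fun pn hpn => h.chiSq_optimalNoise_eq_zero_iff hpn,
    fun pn hpn hne => h.eventually_mse_optimalNoise_lt hcal hpn hne hT,
    fun ν hν => h.exists_abs_mse_sub_le hcal T hν⟩
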